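/- Let $(Z_t)_{t\ge 0}$ be a time-homogeneous Markov process on a Polish space $\Omega$: a jointly measurable process $(t,\omega)\mapsto Z_t(\omega)$ with a measurable family of laws $(\mathbb P_z)_{z\in\Omega}$, $\mathbb P_z(Z_0=z)=1$, satisfying the Markov property $\mathbb P_z(Z_{s+t}\in B\mid Z_u,\,u\le s)=\mathbb P_{Z_s}(Z_t\in B)$ a.s. For a probability measure $\nu$ on $\Omega$ put $\mathbb P_\nu=\int\mathbb P_z\,\nu(dz)$, the law of the process with initial distribution $\nu$. Let $\mu$ be an invariant probability distribution, let $P_t h(z)=\mathbb E_z[h(Z_t)]$ be the associated Markov semigroup, and let $\mathcal L$ be its infinitesimal generator on $L_2(\mu)$, i.e. $\mathcal L h=\lim_{\tau\downarrow0}(P_\tau h-h)/\tau$ in $L_2(\mu)$, with domain the set of $h\in L_2(\mu)$ for which this limit exists. Suppose that, for some $\eta_p>0$, the iterated Poincaré inequality $$\operatorname{Var}_\mu[h]\le \eta_p^{-2}\,\mathbb E_\mu\big[(\mathcal L h)^2\big]\qquad\text{for all } h \text{ in the domain of } \mathcal L$$ holds. Let $p,q\in[1,\infty]$ satisfy $\frac1p+\frac1q=1$,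 and let $\nu$ be a probability measure with $\nu\ll\mu$ and $\|\nu/\mu\|_{L_p(\mu)}<\infty$, where $\nu/\mu=d\nu/d\mu$. Let $f:\Omega\to\mathbb R$ be measurable with $\mathbb E_\mu[f]=0$, $|f|\le M$ and $\operatorname{Var}_\mu[f]\le\sigma^2$. Then, for all $t\ge 0$ and all $\delta\ge 0$, $$\mathbb P_\nu\left(\left|\frac1t\int_0^t f(Z_s)\,ds\right|\ge\delta\right)\le 2\,\|\nu/\mu\|_{L_p(\mu)}\exp\left(-\frac{t\,\eta_p\,\delta^2}{4qM\sqrt{4\sigma^2+\delta^2}}\right).$$ Here $1/q=0$ if $q=\infty$, the fraction in the exponent is read as $0$ if $M=0$ or $\sigma=\delta=0$, and the time average is read as $0$ if $t=0$. -/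

import Mathlib

open MeasureTheory ProbabilityTheory Filter Topology
open scoped NNReal ENNReal

/-- The σ-algebra generated by `Z u`, `u ≤ s`: the past of the process `Z` up to time `s`. -/
@[reducible] def pastSigma {Ω W : Type*} [MeasurableSpace Ω] (Z : ℝ≥0 → W → Ω) (s : ℝ≥0) :
    MeasurableSpace W :=
  ⨆ u ∈ Set.Iic s, MeasurableSpace.comap (Z u) inferInstance

/-- A (time-homogeneous, continuous-time) Markov process with state space `Ω`, realised on the
sample space `W`: a jointly measurable process `Z` together with a measurable family of
probability measures `law z` on `W`, where `law z` is the law under which the process starts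
at `z`, satisfying the Markov property with respect to the natural filtration. No continuity of
the paths is required. -/
structure MarkovProcess (Ω W : Type*) [MeasurableSpace Ω] [MeasurableSpace W] where
  /-- The process `Z t ω`. -/
  Z : ℝ≥0 → W → Ω
  /-- `law z` is the probability given `Z 0 = z`. -/
  law : Kernel Ω W
  isMarkovKernel_law : IsMarkovKernel law
  measurable_Z : Measurable (fun x : ℝ≥0 × W => Z x.1 x.2)
  start : ∀ z : Ω, ∀ᵐ ω ∂(law z), Z 0 ω = z
  markov : ∀ (z : Ω) (s t : ℝ≥0) (B : Set Ω), MeasurableSet B →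
    (law z)⟦Z (s + t) ⁻¹' B | pastSigma Z s⟧
      =ᵐ[law z] fun ω => (law (Z s ω)).real (Z t ⁻¹' B)

namespace MarkovProcess

variable {Ω W : Type*} [MeasurableSpace Ω] [MeasurableSpace W]

/-- The probability measure on the sample space under which `Z 0` has distribution `ν`. -/
noncomputable def lawFrom (X : MarkovProcess Ω W) (ν : Measure Ω) : Measure W :=
  ν.bind X.law

/-- The transition kernel: `transition t z` is the law of `Z t` given `Z 0 = z`. -/
noncomputable def transition (X : MarkovProcess Ω W) (t : ℝ≥0) : Kernel Ω Ω :=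
  X.law.map (X.Z t)

/-- `μ` is an invariant distribution of the process. -/
def IsInvariant (X : MarkovProcess Ω W) (μ : Measure Ω) : Prop :=
  ∀ t : ℝ≥0, (X.transition t).Invariant μ

/-- The Markov semigroup `P_t h (z) = E[h (Z t) | Z 0 = z]`. -/
noncomputable def semigroup (X : MarkovProcess Ω W) (t : ℝ≥0) (h : Ω → ℝ) (z : Ω) : ℝ :=
  ∫ y, h y ∂(X.transition t z)

/-- `h` lies in the domain of the infinitesimal generator of the Markov semigroup on `L²(μ)`,
and the generator maps `h` to `g`: the quotients `(P_τ h - h) / τ` converge to `g` in `L²(μ)` as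
`τ` decreases to `0`. -/
def IsGenerator (X : MarkovProcess Ω W) (μ : Measure Ω) (h g : Ω → ℝ) : Prop :=
  MemLp h 2 μ ∧ MemLp g 2 μ ∧
    Tendsto (fun τ : ℝ≥0 =>
        eLpNorm (fun z => (τ : ℝ)⁻¹ * (X.semigroup τ h z - h z) - g z) 2 μ)
      (𝓝[>] 0) (𝓝 0)

/-- The Markov semigroup admits the iterated Poincaré gap `η > 0`:
`Var_μ[h] ≤ η⁻² E_μ[(𝓛 h)²]` for every `h` in the domain of the generator `𝓛` on `L²(μ)`. -/
def HasIPGap (X : MarkovProcess Ω W) (μ : Measure Ω) (η : ℝ) : Prop :=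
  0 < η ∧ ∀ h g : Ω → ℝ, X.IsGenerator μ h g →
    variance h μ ≤ (η ^ 2)⁻¹ * ∫ z, g z ^ 2 ∂μ

/-- The time average `t⁻¹ ∫₀ᵗ f (Z s) ds` (equal to `0` at `t = 0`). -/
noncomputable def timeAverage (X : MarkovProcess Ω W) (f : Ω → ℝ) (t : ℝ) (ω : W) : ℝ :=
  t⁻¹ * ∫ s in (0 : ℝ)..t, f (X.Z s.toNNReal ω)

end MarkovProcess

/-!
Write `P_μ` for the law of the stationary process. Two reductions come first. Since a probability
`P_z(A)` is at most `1`, Hölder's inequality gives `P_ν(A) ≤ ‖ν/μ‖_p P_μ(A)^{1/q}`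
(`lawFrom_le_eLpNorm_mul_rpow`), so it is enough to treat `ν = μ`. There, by Chernoff's bound, it
is enough to bound `E_μ[exp ∫_0^t v(Z_s) ds]` for `v = θ f` (`integral_exp_pathIntegral_le`).

Let `u_r(z) = E_z[exp ∫_0^r v(Z_s) ds]` be the Feynman–Kac function and let `|v| ≤ K`. It solves
`∂_r u_r = 𝓛 u_r + v u_r`, and `∂_r u_r(z) = E_z[exp(∫_0^r v(Z_s) ds) v(Z_r)]` is bounded by
`K u_r(z)`. Hence `|𝓛 u_r| ≤ 2 K u_r` pointwise, and with `x = 2 K / η < 1` the iterated Poincaré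
inequality reads `Var[u_r] ≤ x² (Var[u_r] + (∫ u_r dμ)²)`. So `u_r` is almost constant, and as `v`
has mean zero, the derivative `∫ v u_r dμ = Cov(v, u_r)` of `∫ u_r dμ` is at most
`√Var[v] · x / √(1 - x²) · ∫ u_r dμ` (`integral_mul_feynmanKac_le`). Grönwall's inequality gives
`E_μ[exp ∫_0^t v(Z_s) ds] ≤ exp(t √Var[v] x / √(1 - x²))` without a prefactor, and the choice
`x = δ / √(4 σ² + δ²)` gives the exponent of the theorem.

That `u_r` lies in the domain of `𝓛` is shown on the paths (`isGenerator_feynmanKac`). The Markov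
property gives `P_τ u_r(z) = E_z[exp ∫_τ^{τ+r} v(Z_s) ds]` (`semigroup_feynmanKac`), and the
difference quotients converge because `τ⁻¹ ∫_r^{r+τ} v(Z_s) ds → v(Z_r)` in `L¹(P_μ)`. Although the
paths need not be continuous, this follows from stationarity and Lebesgue's differentiation theorem
along each path (`tendsto_oscillation`).
-/

/-! ### The Markov property for finite-dimensional distributions and moments -/

namespace MarkovProcess

variable {Ω W : Type*} [MeasurableSpace Ω] [MeasurableSpace W]

instance (X : MarkovProcess Ω W) : IsMarkovKernel X.law := X.isMarkovKernel_law

lemma measurable_Z_time (X : MarkovProcess Ω W) (s : ℝ≥0) : Measurable (X.Z s) :=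
  X.measurable_Z.comp measurable_prodMk_left

instance (X : MarkovProcess Ω W) (t : ℝ≥0) : IsMarkovKernel (X.transition t) :=
  Kernel.IsMarkovKernel.map _ (X.measurable_Z_time t)

lemma pastSigma_le (X : MarkovProcess Ω W) (s : ℝ≥0) :
    pastSigma X.Z s ≤ (inferInstance : MeasurableSpace W) :=
  iSup₂_le fun u _ => (X.measurable_Z_time u).comap_le

lemma measurable_pastSigma (X : MarkovProcess Ω W) {u s : ℝ≥0} (h : u ≤ s) :
    Measurable[pastSigma X.Z s] (X.Z u) := by
  rw [measurable_iff_comap_le]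
  exact le_iSup₂_of_le u h le_rfl

lemma transition_apply' (X : MarkovProcess Ω W) (t : ℝ≥0) (z : Ω) :
    X.transition t z = (X.law z).map (X.Z t) :=
  Kernel.map_apply _ (X.measurable_Z_time t) z

lemma lintegral_transition (X : MarkovProcess Ω W) (t : ℝ≥0) (z : Ω) {g : Ω → ℝ≥0∞}
    (hg : Measurable g) :
    ∫⁻ y, g y ∂(X.transition t z) = ∫⁻ ω, g (X.Z t ω) ∂(X.law z) := by
  rw [transition_apply', lintegral_map hg (X.measurable_Z_time t)]

/-- The Markov property on events of the past. -/
lemma law_inter_preimage (X : MarkovProcess Ω W) (z : Ω) (s t : ℝ≥0) {A : Set W}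
    (hA : MeasurableSet[pastSigma X.Z s] A) {B : Set Ω} (hB : MeasurableSet B) :
    X.law z (X.Z (s + t) ⁻¹' B ∩ A) = ∫⁻ ω in A, X.transition t (X.Z s ω) B ∂(X.law z) := by
  have hm := X.pastSigma_le s
  have hA' := hm A hA
  have hS : MeasurableSet (X.Z (s + t) ⁻¹' B) := X.measurable_Z_time _ hB
  have h1 : ∫ ω in A, (X.law (X.Z s ω)).real (X.Z t ⁻¹' B) ∂(X.law z)
      = (X.law z).real (X.Z (s + t) ⁻¹' B ∩ A) := by
    have h2 := setIntegral_condExp (μ := X.law z) hm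
      (f := (X.Z (s + t) ⁻¹' B).indicator (fun _ => (1 : ℝ)))
      ((integrable_const 1).indicator hS) hA
    rw [setIntegral_congr_ae hA' ((X.markov z s t B hB).mono fun ω h _ => h)] at h2
    rw [h2, integral_indicator hS]
    simp [Measure.restrict_restrict hS]
  have hmeas : Measurable fun ω => X.law (X.Z s ω) (X.Z t ⁻¹' B) :=
    (X.law.measurable_coe (X.measurable_Z_time t hB)).comp (X.measurable_Z_time s)
  have h3 : ∀ ω, X.transition t (X.Z s ω) B = X.law (X.Z s ω) (X.Z t ⁻¹' B) := fun ω => by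
    rw [transition_apply', Measure.map_apply (X.measurable_Z_time t) hB]
  simp_rw [h3]
  simp only [Measure.real] at h1
  rw [integral_toReal hmeas.aemeasurable (ae_of_all _ fun ω => measure_lt_top _ _)] at h1
  refine ((ENNReal.toReal_eq_toReal_iff' (measure_ne_top _ _) ?_).1 h1.symm)
  refine (lt_of_le_of_lt (lintegral_mono (g := fun _ => 1) fun ω => prob_le_one) ?_).ne
  simp

/-- The Markov property, tested against a nonnegative functional `Ψ` of the past. -/
lemma lintegral_past_mul (X : MarkovProcess Ω W) (z : Ω) (s t : ℝ≥0) {Ψ : W → ℝ≥0∞}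
    (hΨ : Measurable[pastSigma X.Z s] Ψ) {g : Ω → ℝ≥0∞} (hg : Measurable g) :
    ∫⁻ ω, Ψ ω * g (X.Z (s + t) ω) ∂(X.law z)
      = ∫⁻ ω, Ψ ω * ∫⁻ y, g y ∂(X.transition t (X.Z s ω)) ∂(X.law z) := by
  have hm := X.pastSigma_le s
  have hg1 : Measurable fun ω => g (X.Z (s + t) ω) := hg.comp (X.measurable_Z_time _)
  have hg2 : Measurable fun ω => ∫⁻ y, g y ∂(X.transition t (X.Z s ω)) :=
    hg.lintegral_kernel.comp (X.measurable_Z_time _)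
  have key : ∀ A : Set W, MeasurableSet[pastSigma X.Z s] A →
      ∫⁻ ω in A, g (X.Z (s + t) ω) ∂(X.law z)
        = ∫⁻ ω in A, ∫⁻ y, g y ∂(X.transition t (X.Z s ω)) ∂(X.law z) := by
    intro A hA
    have e : ((X.law z).restrict A).map (X.Z (s + t))
        = (((X.law z).restrict A).map (X.Z s)).bind (X.transition t) := by
      ext B hB
      rw [Measure.map_apply (X.measurable_Z_time _) hB,
        Measure.restrict_apply (X.measurable_Z_time _ hB), X.law_inter_preimage z s t hA hB,
        Measure.bind_apply hB (X.transition t).measurable.aemeasurable,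
        lintegral_map ((X.transition t).measurable_coe hB) (X.measurable_Z_time s)]
    rw [← lintegral_map hg (X.measurable_Z_time _), e,
      Measure.lintegral_bind (X.transition t).measurable.aemeasurable hg.aemeasurable,
      lintegral_map hg.lintegral_kernel (X.measurable_Z_time s)]
  have hmul : ∀ {Φ G : W → ℝ≥0∞}, Measurable[pastSigma X.Z s] Φ → Measurable G →
      Measurable fun ω => Φ ω * G ω := fun h1 h2 => (h1.mono hm le_rfl).mul h2
  refine @Measurable.ennreal_induction W (pastSigma X.Z s)
    (fun Ψ => ∫⁻ ω, Ψ ω * g (X.Z (s + t) ω) ∂(X.law z)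
      = ∫⁻ ω, Ψ ω * ∫⁻ y, g y ∂(X.transition t (X.Z s ω)) ∂(X.law z)) ?_ ?_ ?_ Ψ hΨ
  · intro c A hA
    have h1 : ∀ G : W → ℝ≥0∞, Measurable G →
        ∫⁻ ω, A.indicator (fun _ => c) ω * G ω ∂(X.law z) = c * ∫⁻ ω in A, G ω ∂(X.law z) := by
      intro G hG
      rw [← lintegral_const_mul c hG, ← lintegral_indicator (hm A hA)]
      refine lintegral_congr fun ω => ?_
      by_cases h : ω ∈ A <;> simp [h]
    rw [h1 _ hg1, h1 _ hg2, key A hA]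
  · intro φ ψ _ hφ hψ e1 e2
    simp only [Pi.add_apply, add_mul]
    rw [lintegral_add_left (hmul hφ hg1), e1, e2, ← lintegral_add_left (hmul hφ hg2)]
  · intro φ hφ hmono e
    simp only [ENNReal.iSup_mul]
    rw [lintegral_iSup (fun n => hmul (hφ n) hg1)
        (fun i j h ω => mul_le_mul_left (hmono h ω) _),
      lintegral_iSup (fun n => hmul (hφ n) hg2)
        (fun i j h ω => mul_le_mul_left (hmono h ω) _)]
    exact iSup_congr e

/-- The finite-dimensional Markov property at time `τ`. -/
lemma lintegral_finset_prod (X : MarkovProcess Ω W) (τ : ℝ≥0) (I : Finset ℝ≥0) :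
    ∀ (φ : ℝ≥0 → Ω → ℝ≥0∞), (∀ s, Measurable (φ s)) → ∀ z,
      ∫⁻ ω, ∏ s ∈ I, φ s (X.Z (τ + s) ω) ∂(X.law z)
        = ∫⁻ ω, ∫⁻ ω', ∏ s ∈ I, φ s (X.Z s ω') ∂(X.law (X.Z τ ω)) ∂(X.law z) := by
  classical
  induction I using Finset.induction_on_max with
  | empty => intro φ hφ z; simp
  | insert m I hI ih =>
    intro φ hφ z
    have hmI : m ∉ I := fun h => lt_irrefl _ (hI m h)
    simp only [Finset.prod_insert hmI]
    rcases I.eq_empty_or_nonempty with rfl | hne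
    · have h := X.lintegral_past_mul z τ m (Ψ := fun _ => 1) measurable_const (hφ m)
      simp only [one_mul] at h
      simp only [Finset.prod_empty, mul_one, h]
      exact lintegral_congr fun ω => X.lintegral_transition _ _ (hφ m)
    · set k := I.max' hne with hk
      have hkI : k ∈ I := I.max'_mem hne
      have hkm : k + (m - k) = m := add_tsub_cancel_of_le (hI k hkI).le
      set G : Ω → ℝ≥0∞ := fun x => ∫⁻ y, φ m y ∂(X.transition (m - k) x) with hG
      have hGm : Measurable G := (hφ m).lintegral_kernel
      have step : ∀ (σ : ℝ≥0) (z : Ω),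
          ∫⁻ ω, φ m (X.Z (σ + m) ω) * ∏ s ∈ I, φ s (X.Z (σ + s) ω) ∂(X.law z)
            = ∫⁻ ω, ∏ s ∈ I, (if s = k then φ s * G else φ s) (X.Z (σ + s) ω) ∂(X.law z) := by
        intro σ z
        have h := X.lintegral_past_mul z (σ + k) (m - k)
          (Ψ := fun ω => ∏ s ∈ I, φ s (X.Z (σ + s) ω))
          (Finset.measurable_fun_prod _ fun s hs => (hφ s).comp
            (X.measurable_pastSigma (by gcongr; exact I.le_max' s hs))) (hφ m)
        rw [add_assoc, hkm] at h
        simp_rw [mul_comm (φ m _), h]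
        refine lintegral_congr fun ω => ?_
        have : ∀ s, (if s = k then φ s * G else φ s) (X.Z (σ + s) ω)
            = φ s (X.Z (σ + s) ω) * (if s = k then G (X.Z (σ + s) ω) else 1) := by
          intro s; split_ifs <;> simp
        simp_rw [this, Finset.prod_mul_distrib, Finset.prod_ite_eq' I k, if_pos hkI]
        rfl
      have step0 := step 0
      simp only [zero_add] at step0
      rw [step τ z, ih _ (fun s => by split_ifs; exacts [(hφ s).mul hGm, hφ s]) z]
      simp_rw [step0]

/-- The nonnegative additive functional `∫_S F(Z_{τ+s}) ds`. -/
noncomputable def lAdditive (X : MarkovProcess Ω W) (F : Ω → ℝ≥0∞) (τ : ℝ≥0) (S : Set ℝ)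
    (ω : W) : ℝ≥0∞ :=
  ∫⁻ s in S, F (X.Z (τ + s.toNNReal) ω)

lemma measurable_uncurry_Z_add (X : MarkovProcess Ω W) (τ : ℝ≥0) :
    Measurable fun x : ℝ × W => X.Z (τ + x.1.toNNReal) x.2 :=
  X.measurable_Z.comp ((measurable_const.add
    (measurable_real_toNNReal.comp measurable_fst)).prodMk measurable_snd)

lemma measurable_lAdditive (X : MarkovProcess Ω W) {F : Ω → ℝ≥0∞} (hF : Measurable F) (τ : ℝ≥0)
    (S : Set ℝ) : Measurable (X.lAdditive F τ S) :=
  (hF.comp (X.measurable_uncurry_Z_add τ)).lintegral_prod_left'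

/-- The Markov property at time `τ` for moments of an additive functional. The list of extra times
makes the induction on `n` work: each step moves one time variable into the list. -/
lemma lintegral_list_mul_lAdditive_pow (X : MarkovProcess Ω W) {F : Ω → ℝ≥0∞} (hF : Measurable F)
    (τ : ℝ≥0) (S : Set ℝ) (z : Ω) (n : ℕ) : ∀ l : List ℝ≥0,
      ∫⁻ ω, (l.map fun s => F (X.Z (τ + s) ω)).prod * X.lAdditive F τ S ω ^ n ∂(X.law z)
        = ∫⁻ ω, ∫⁻ ω', (l.map fun s => F (X.Z s ω')).prod * X.lAdditive F 0 S ω' ^ n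
            ∂(X.law (X.Z τ ω)) ∂(X.law z) := by
  have hlist : ∀ (σ : ℝ≥0) (l : List ℝ≥0),
      Measurable fun ω => (l.map fun s => F (X.Z (σ + s) ω)).prod := by
    intro σ l
    induction l with
    | nil => simp
    | cons a l ih =>
      simp only [List.map_cons, List.prod_cons]
      exact (hF.comp (X.measurable_Z_time _)).mul ih
  induction n with
  | zero =>
    intro l
    classical
    have h := X.lintegral_finset_prod τ l.toFinset (fun s x => F x ^ l.count s)
      (fun s => hF.pow_const _) z
    simpa only [pow_zero, mul_one, Finset.prod_list_map_count] using h
  | succ n ih =>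
    intro l
    have expand : ∀ (σ : ℝ≥0) (z : Ω),
        ∫⁻ ω, (l.map fun s => F (X.Z (σ + s) ω)).prod * X.lAdditive F σ S ω ^ (n + 1) ∂(X.law z)
          = ∫⁻ s in S, ∫⁻ ω, ((s.toNNReal :: l).map fun s => F (X.Z (σ + s) ω)).prod
              * X.lAdditive F σ S ω ^ n ∂(X.law z) := by
      intro σ z
      have hm : Measurable fun x : ℝ × W =>
          ((x.1.toNNReal :: l).map fun s => F (X.Z (σ + s) x.2)).prod
              * X.lAdditive F σ S x.2 ^ n := by
        simp only [List.map_cons, List.prod_cons]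
        exact ((hF.comp (X.measurable_uncurry_Z_add σ)).mul
          ((hlist σ l).comp measurable_snd)).mul
            (((X.measurable_lAdditive hF σ S).comp measurable_snd).pow_const _)
      rw [lintegral_lintegral_swap hm.aemeasurable]
      refine lintegral_congr fun ω => ?_
      simp only [List.map_cons, List.prod_cons]
      have h1 : Measurable fun s : ℝ => F (X.Z (σ + s.toNNReal) ω) :=
        (hF.comp (X.measurable_uncurry_Z_add σ)).comp measurable_prodMk_right
      simp_rw [mul_assoc]
      rw [lintegral_mul_const _ h1]
      change _ = X.lAdditive F σ S ω * _
      ring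
    have expand0 := expand 0
    simp only [zero_add] at expand0
    rw [expand τ z]
    simp_rw [ih, expand0]
    have hm : Measurable fun x : ℝ × W =>
        ((x.1.toNNReal :: l).map fun s => F (X.Z s x.2)).prod * X.lAdditive F 0 S x.2 ^ n := by
      simp only [List.map_cons, List.prod_cons]
      have h1 := X.measurable_uncurry_Z_add 0
      have h2 := hlist 0 l
      simp only [zero_add] at h1 h2
      exact ((hF.comp h1).mul (h2.comp measurable_snd)).mul
          (((X.measurable_lAdditive hF 0 S).comp measurable_snd).pow_const _)
    refine lintegral_lintegral_swap (Measurable.aemeasurable ?_)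
    let κ : Kernel (ℝ × W) W := X.law.comap (fun p => X.Z τ p.2)
      ((X.measurable_Z_time τ).comp measurable_snd)
    have := Measurable.lintegral_kernel_prod_right' (κ := κ)
      (f := fun p : (ℝ × W) × W =>
        ((p.1.1.toNNReal :: l).map fun s => F (X.Z s p.2)).prod * X.lAdditive F 0 S p.2 ^ n)
      (hm.comp ((measurable_fst.comp measurable_fst).prodMk measurable_snd))
    exact this

end MarkovProcess

/-! ### Path integrals and Feynman–Kac functions -/

namespace MarkovProcess

variable {Ω W : Type*} [MeasurableSpace Ω] [MeasurableSpace W]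

/-- The additive functional `∫_a^b v(Z_s) ds`. As in `timeAverage`, times are real numbers, and
negative ones are read as `0`. -/
noncomputable def pathIntegral (X : MarkovProcess Ω W) (v : Ω → ℝ) (a b : ℝ) (ω : W) : ℝ :=
  ∫ s in a..b, v (X.Z s.toNNReal ω)

/-- The Feynman–Kac function `z ↦ E_z[exp ∫_0^r v(Z_s) ds]`. -/
noncomputable def feynmanKac (X : MarkovProcess Ω W) (v : Ω → ℝ) (r : ℝ) (z : Ω) : ℝ :=
  ∫ ω, Real.exp (X.pathIntegral v 0 r ω) ∂(X.law z)

variable (X : MarkovProcess Ω W) {v : Ω → ℝ} {K : ℝ}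

lemma measurable_comp_Z_uncurry (hv : Measurable v) :
    Measurable fun x : ℝ × W => v (X.Z x.1.toNNReal x.2) :=
  hv.comp (X.measurable_Z.comp
    ((measurable_real_toNNReal.comp measurable_fst).prodMk measurable_snd))

lemma measurable_comp_Z_path (hv : Measurable v) (ω : W) :
    Measurable fun s : ℝ => v (X.Z s.toNNReal ω) :=
  (X.measurable_comp_Z_uncurry hv).comp measurable_prodMk_right

lemma intervalIntegrable_comp_Z (hv : Measurable v) (hK : ∀ z, |v z| ≤ K) (ω : W) (a b : ℝ) :
    IntervalIntegrable (fun s : ℝ => v (X.Z s.toNNReal ω)) volume a b := by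
  rw [intervalIntegrable_iff]
  exact Measure.integrableOn_of_bounded (M := K) (by simp)
    (X.measurable_comp_Z_path hv ω).aestronglyMeasurable (ae_of_all _ fun s => hK _)

lemma measurable_pathIntegral (hv : Measurable v) (a b : ℝ) :
    Measurable (X.pathIntegral v a b) := by
  have h := (X.measurable_comp_Z_uncurry hv).stronglyMeasurable
  unfold pathIntegral
  simp only [intervalIntegral]
  exact ((h.integral_prod_left' (μ := volume.restrict _)).sub
    (h.integral_prod_left' (μ := volume.restrict _))).measurable

lemma abs_pathIntegral_le (hK : ∀ z, |v z| ≤ K) (a b : ℝ) (ω : W) :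
    |X.pathIntegral v a b ω| ≤ K * |b - a| := by
  rw [← Real.norm_eq_abs]
  exact intervalIntegral.norm_integral_le_of_norm_le_const fun _ _ => hK _

lemma pathIntegral_add (hv : Measurable v) (hK : ∀ z, |v z| ≤ K) (a b c : ℝ) (ω : W) :
    X.pathIntegral v a b ω + X.pathIntegral v b c ω = X.pathIntegral v a c ω :=
  intervalIntegral.integral_add_adjacent_intervals (X.intervalIntegrable_comp_Z hv hK ω a b)
    (X.intervalIntegrable_comp_Z hv hK ω b c)

lemma exp_pathIntegral_le (hK : ∀ z, |v z| ≤ K) (a b : ℝ) (ω : W) :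
    Real.exp (X.pathIntegral v a b ω) ≤ Real.exp (K * |b - a|) :=
  Real.exp_le_exp.2 ((le_abs_self _).trans (X.abs_pathIntegral_le hK a b ω))

lemma integrable_exp_pathIntegral (hv : Measurable v) (hK : ∀ z, |v z| ≤ K) (a b : ℝ)
    (P : Measure W) [IsFiniteMeasure P] :
    Integrable (fun ω => Real.exp (X.pathIntegral v a b ω)) P :=
  Integrable.of_bound (X.measurable_pathIntegral hv a b).exp.aestronglyMeasurable
    (Real.exp (K * |b - a|)) (ae_of_all _ fun ω => by
      simpa using X.exp_pathIntegral_le hK a b ω)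

lemma stronglyMeasurable_feynmanKac (hv : Measurable v) (r : ℝ) :
    StronglyMeasurable (X.feynmanKac v r) :=
  (X.measurable_pathIntegral hv 0 r).exp.stronglyMeasurable.integral_kernel

lemma feynmanKac_nonneg (r : ℝ) (z : Ω) : 0 ≤ X.feynmanKac v r z :=
  integral_nonneg fun _ => (Real.exp_pos _).le

lemma feynmanKac_le (hv : Measurable v) (hK : ∀ z, |v z| ≤ K) (r : ℝ) (z : Ω) :
    X.feynmanKac v r z ≤ Real.exp (K * |r|) := by
  have h := integral_mono (X.integrable_exp_pathIntegral hv hK 0 r (X.law z))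
    (integrable_const (Real.exp (K * |r|)))
    (fun ω => by simpa using X.exp_pathIntegral_le hK 0 r ω)
  simpa [feynmanKac] using h

lemma ofReal_feynmanKac (hv : Measurable v) (hK : ∀ z, |v z| ≤ K) (r : ℝ) (z : Ω) :
    ENNReal.ofReal (X.feynmanKac v r z)
      = ∫⁻ ω, ENNReal.ofReal (Real.exp (X.pathIntegral v 0 r ω)) ∂(X.law z) :=
  ofReal_integral_eq_lintegral_ofReal (X.integrable_exp_pathIntegral hv hK 0 r _)
    (ae_of_all _ fun _ => (Real.exp_pos _).le)

/-- Adding the constant `K` makes the integrand nonnegative. -/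
lemma lAdditive_eq_ofReal (hv : Measurable v) (hK : ∀ z, |v z| ≤ K) (τ : ℝ≥0) {r : ℝ}
    (hr : 0 ≤ r) (ω : W) :
    X.lAdditive (fun z => ENNReal.ofReal (v z + K)) τ (Set.Ioc 0 r) ω
      = ENNReal.ofReal (X.pathIntegral v τ (τ + r) ω + K * r) := by
  have h0 : ∀ z, 0 ≤ v z + K := fun z => by linarith [(abs_le.1 (hK z)).1]
  have hm : Measurable fun s : ℝ => v (X.Z (τ + s.toNNReal) ω) :=
    hv.comp ((X.measurable_uncurry_Z_add τ).comp measurable_prodMk_right)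
  have hi : IntegrableOn (fun s : ℝ => v (X.Z (τ + s.toNNReal) ω)) (Set.Ioc 0 r) :=
    Measure.integrableOn_of_bounded (M := K) (by simp) hm.aestronglyMeasurable
      (ae_of_all _ fun s => hK _)
  have hc : IntegrableOn (fun _ : ℝ => K) (Set.Ioc 0 r) := by simp
  unfold lAdditive
  have h1 := ofReal_integral_eq_lintegral_ofReal (hi.add hc) (ae_of_all _ fun s => h0 _)
  simp only [Pi.add_apply] at h1
  rw [← h1]
  congr 1
  rw [integral_add hi hc]
  congr 1
  · unfold pathIntegral
    have := intervalIntegral.integral_comp_add_left (a := 0) (b := r)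
      (fun s => v (X.Z s.toNNReal ω)) (τ : ℝ)
    rw [add_zero] at this
    rw [← this, intervalIntegral.integral_of_le hr]
    refine setIntegral_congr_fun measurableSet_Ioc fun s hs => ?_
    rw [Real.toNNReal_add τ.coe_nonneg hs.1.le, Real.toNNReal_coe]
  · simp [hr, mul_comm]

lemma ofReal_exp_eq_tsum {y : ℝ} (hy : 0 ≤ y) :
    ENNReal.ofReal (Real.exp y)
      = ∑' n : ℕ, ENNReal.ofReal ((n.factorial : ℝ)⁻¹) * ENNReal.ofReal y ^ n := by
  have h : HasSum (fun n : ℕ => (n.factorial : ℝ)⁻¹ * y ^ n) (Real.exp y) := by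
    have := NormedSpace.expSeries_div_hasSum_exp (𝔸 := ℝ) y
    rw [← Real.exp_eq_exp_ℝ] at this
    simpa [div_eq_inv_mul] using this
  rw [← h.tsum_eq, ENNReal.ofReal_tsum_of_nonneg (fun n => by positivity) h.summable]
  exact tsum_congr fun n => by
    rw [ENNReal.ofReal_mul (by positivity), ENNReal.ofReal_pow hy]

/-- The Markov property at time `τ` for the exponential of a path integral. The path integral need
not be measurable with respect to the σ-algebra generated by the process, so its law is reached
through its moments, which depend on the finite-dimensional distributions only. -/
lemma lintegral_exp_pathIntegral_shift (hv : Measurable v) (hK : ∀ z, |v z| ≤ K) (τ : ℝ≥0)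
    {r : ℝ} (hr : 0 ≤ r) (z : Ω) :
    ∫⁻ ω, ENNReal.ofReal (Real.exp (X.pathIntegral v τ (τ + r) ω)) ∂(X.law z)
      = ∫⁻ ω, ENNReal.ofReal (X.feynmanKac v r (X.Z τ ω)) ∂(X.law z) := by
  set F : Ω → ℝ≥0∞ := fun z => ENNReal.ofReal (v z + K) with hF
  have hFm : Measurable F := (hv.add_const K).ennreal_ofReal
  have hpt : ∀ (σ : ℝ≥0) ω, ENNReal.ofReal (Real.exp (X.pathIntegral v σ (σ + r) ω))
      = ∑' n : ℕ, ENNReal.ofReal (Real.exp (-(K * r))) * ENNReal.ofReal ((n.factorial : ℝ)⁻¹)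
          * X.lAdditive F σ (Set.Ioc 0 r) ω ^ n := by
    intro σ ω
    have hy : 0 ≤ X.pathIntegral v σ (σ + r) ω + K * r := by
      have := X.abs_pathIntegral_le hK σ (σ + r) ω
      rw [add_sub_cancel_left, abs_of_nonneg hr] at this
      linarith [(abs_le.1 this).1]
    simp_rw [mul_assoc]
    rw [ENNReal.tsum_mul_left, X.lAdditive_eq_ofReal hv hK σ hr, ← ofReal_exp_eq_tsum hy,
      ← ENNReal.ofReal_mul (Real.exp_pos _).le, ← Real.exp_add]
    congr 2
    ring
  have hm : ∀ (σ : ℝ≥0) (n : ℕ), Measurable fun ω => X.lAdditive F σ (Set.Ioc 0 r) ω ^ n :=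
    fun σ n => (X.measurable_lAdditive hFm σ _).pow_const n
  have hexp : ∀ (σ : ℝ≥0) z,
      ∫⁻ ω, ENNReal.ofReal (Real.exp (X.pathIntegral v σ (σ + r) ω)) ∂(X.law z)
      = ∑' n : ℕ, ENNReal.ofReal (Real.exp (-(K * r))) * ENNReal.ofReal ((n.factorial : ℝ)⁻¹)
          * ∫⁻ ω, X.lAdditive F σ (Set.Ioc 0 r) ω ^ n ∂(X.law z) := by
    intro σ z
    simp_rw [hpt]
    rw [lintegral_tsum fun n => ((hm σ n).const_mul _).aemeasurable]
    exact tsum_congr fun n => lintegral_const_mul _ (hm σ n)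
  have hexp0 := hexp 0
  simp only [NNReal.coe_zero, zero_add] at hexp0
  simp_rw [X.ofReal_feynmanKac hv hK, hexp0]
  have hk : ∀ n, Measurable fun ω =>
      ∫⁻ ω', X.lAdditive F 0 (Set.Ioc 0 r) ω' ^ n ∂(X.law (X.Z τ ω)) := fun n =>
    (hm 0 n).lintegral_kernel.comp (X.measurable_Z_time τ)
  rw [hexp, lintegral_tsum fun n => ((hk n).const_mul _).aemeasurable]
  refine tsum_congr fun n => ?_
  rw [lintegral_const_mul _ (hk n)]
  congr 1
  simpa using X.lintegral_list_mul_lAdditive_pow hFm τ (Set.Ioc 0 r) z n []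

/-- The semigroup acts on a Feynman–Kac function by shifting the time window. -/
lemma semigroup_feynmanKac (hv : Measurable v) (hK : ∀ z, |v z| ≤ K) (τ : ℝ≥0)
    {r : ℝ} (hr : 0 ≤ r) (z : Ω) :
    X.semigroup τ (X.feynmanKac v r) z
      = ∫ ω, Real.exp (X.pathIntegral v τ (τ + r) ω) ∂(X.law z) := by
  have hs := X.stronglyMeasurable_feynmanKac hv r
  unfold semigroup
  rw [transition_apply', integral_map (X.measurable_Z_time τ).aemeasurable
      hs.aestronglyMeasurable,
    integral_eq_lintegral_of_nonneg_ae (ae_of_all _ fun ω => X.feynmanKac_nonneg r _)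
      (hs.comp_measurable (X.measurable_Z_time τ)).aestronglyMeasurable,
    integral_eq_lintegral_of_nonneg_ae (ae_of_all _ fun ω => (Real.exp_pos _).le)
      (X.measurable_pathIntegral hv _ _).exp.aestronglyMeasurable,
    X.lintegral_exp_pathIntegral_shift hv hK τ hr z]

end MarkovProcess

/-! ### Stationarity and short-time averages -/

/-- Right-sided Lebesgue points of a bounded measurable function on the line. -/
lemma ae_tendsto_lintegral_enorm_add_sub {x : ℝ → ℝ} (hx : Measurable x) {K : ℝ}
    (hK : ∀ s, |x s| ≤ K) :
    ∀ᵐ r, Tendsto (fun τ : ℝ => (∫⁻ s in Set.Ioc 0 τ, ‖x (r + s) - x r‖ₑ) / ENNReal.ofReal τ)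
      (𝓝[>] 0) (𝓝 0) := by
  have hloc : LocallyIntegrable x volume := fun r =>
    ⟨Set.Icc (r - 1) (r + 1), Icc_mem_nhds (by linarith) (by linarith),
      Measure.integrableOn_of_bounded (M := K) (by simp) hx.aestronglyMeasurable
        (ae_of_all _ fun s => hK s)⟩
  filter_upwards [(IsUnifLocDoublingMeasure.vitaliFamily (volume : Measure ℝ)
    1).ae_tendsto_lintegral_enorm_sub_div hloc] with r hr
  have h1 : Tendsto (fun τ : ℝ => r + τ) (𝓝[>] 0) (𝓝[>] r) := by
    refine tendsto_nhdsWithin_iff.2 ⟨?_, ?_⟩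
    · have : Tendsto (fun τ : ℝ => r + τ) (𝓝 0) (𝓝 (r + 0)) :=
        (continuous_const.add continuous_id).tendsto 0
      rw [add_zero] at this
      exact this.mono_left nhdsWithin_le_nhds
    · filter_upwards [self_mem_nhdsWithin] with τ hτ
      simpa using hτ
  have h2 := (hr.comp (Real.tendsto_Icc_vitaliFamily_right r)).comp h1
  refine h2.congr fun τ => ?_
  simp only [Function.comp_apply, Real.volume_Icc, add_sub_cancel_left]
  congr 1
  rw [Measure.restrict_congr_set Ioc_ae_eq_Icc.symm]
  have := (measurePreserving_add_left volume r).setLIntegral_comp_preimage_emb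
    (measurableEmbedding_addLeft r) (fun y => ‖x y - x r‖ₑ) (Set.Ioc r (r + τ))
  rw [← this]
  simp

namespace MarkovProcess

variable {Ω W : Type*} [MeasurableSpace Ω] [MeasurableSpace W]

variable (X : MarkovProcess Ω W) {v : Ω → ℝ} {K : ℝ}

instance (ν : Measure Ω) [IsProbabilityMeasure ν] : IsProbabilityMeasure (X.lawFrom ν) := by
  unfold lawFrom; infer_instance

lemma lintegral_lawFrom (ν : Measure Ω) {F : W → ℝ≥0∞} (hF : Measurable F) :
    ∫⁻ ω, F ω ∂(X.lawFrom ν) = ∫⁻ z, ∫⁻ ω, F ω ∂(X.law z) ∂ν :=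
  Measure.lintegral_bind X.law.measurable.aemeasurable hF.aemeasurable

lemma integral_lawFrom (ν : Measure Ω) [IsProbabilityMeasure ν] {F : W → ℝ}
    (hF : Integrable F (X.lawFrom ν)) :
    ∫ ω, F ω ∂(X.lawFrom ν) = ∫ z, ∫ ω, F ω ∂(X.law z) ∂ν := by
  have h : X.lawFrom ν = (ν ⊗ₘ X.law).map Prod.snd := (Measure.snd_compProd ν X.law).symm
  rw [h] at hF ⊢
  rw [integral_map measurable_snd.aemeasurable hF.aestronglyMeasurable]
  exact Measure.integral_compProd (hF.comp_measurable measurable_snd)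

variable {μ : Measure Ω}

/-- Under the stationary law the pair `(Z_r, Z_{r+s})` has the same distribution for all `r`. -/
lemma map_prodMk_lawFrom [IsProbabilityMeasure μ] (hμ : X.IsInvariant μ) (r s : ℝ≥0) :
    (X.lawFrom μ).map (fun ω => (X.Z r ω, X.Z (r + s) ω)) = μ ⊗ₘ X.transition s := by
  have hm : Measurable fun ω => (X.Z r ω, X.Z (r + s) ω) :=
    (X.measurable_Z_time r).prodMk (X.measurable_Z_time (r + s))
  have := Measure.isProbabilityMeasure_map (μ := X.lawFrom μ) hm.aemeasurable
  refine Measure.ext_prod fun {A B} hA hB => ?_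
  have hg : Measurable fun y => A.indicator (fun y => X.transition s y B) y :=
    ((X.transition s).measurable_coe hB).indicator hA
  rw [Measure.map_apply hm (hA.prod hB), Measure.compProd_apply_prod hA hB, lawFrom,
    Measure.bind_apply (hm (hA.prod hB)) X.law.measurable.aemeasurable, ← lintegral_indicator hA]
  conv_rhs => rw [← (hμ r).def]
  rw [Measure.lintegral_bind (X.transition r).measurable.aemeasurable hg.aemeasurable]
  refine lintegral_congr fun z => ?_
  rw [X.lintegral_transition r z hg]
  have hA' : MeasurableSet[pastSigma X.Z r] (X.Z r ⁻¹' A) := X.measurable_pastSigma le_rfl hA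
  have e : (fun ω => (X.Z r ω, X.Z (r + s) ω)) ⁻¹' A ×ˢ B = X.Z (r + s) ⁻¹' B ∩ X.Z r ⁻¹' A := by
    ext ω; simp [and_comm]
  rw [e, X.law_inter_preimage z r s hA' hB, ← lintegral_indicator (X.measurable_Z_time r hA)]
  rfl

/-- The mean absolute increment of `v(Z)` over a time interval of length `s`, under the stationary
law. -/
noncomputable def meanIncrement (X : MarkovProcess Ω W) (μ : Measure Ω) (v : Ω → ℝ) (s : ℝ≥0) :
    ℝ≥0∞ :=
  ∫⁻ p, ‖v p.2 - v p.1‖ₑ ∂(μ ⊗ₘ X.transition s)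

/-- The average over `s ∈ (0, τ]` of `meanIncrement`. -/
noncomputable def oscillation (X : MarkovProcess Ω W) (μ : Measure Ω) (v : Ω → ℝ) (τ : ℝ) :
    ℝ≥0∞ :=
  (∫⁻ s in Set.Ioc 0 τ, X.meanIncrement μ v s.toNNReal) / ENNReal.ofReal τ

variable [IsProbabilityMeasure μ]

lemma lintegral_enorm_increment (hμ : X.IsInvariant μ) (hv : Measurable v) {r s : ℝ}
    (hr : 0 ≤ r) (hs : 0 ≤ s) :
    ∫⁻ ω, ‖v (X.Z (r + s).toNNReal ω) - v (X.Z r.toNNReal ω)‖ₑ ∂(X.lawFrom μ)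
      = X.meanIncrement μ v s.toNNReal := by
  rw [meanIncrement, ← X.map_prodMk_lawFrom hμ r.toNNReal, lintegral_map, Real.toNNReal_add hr hs]
  · exact ((hv.comp measurable_snd).sub (hv.comp measurable_fst)).enorm
  · exact (X.measurable_Z_time _).prodMk (X.measurable_Z_time _)

lemma measurable_enorm_increment (hv : Measurable v) :
    Measurable fun p : (ℝ × W) × ℝ =>
      ‖v (X.Z (p.1.1 + p.2).toNNReal p.1.2) - v (X.Z p.1.1.toNNReal p.1.2)‖ₑ := by
  have h := X.measurable_comp_Z_uncurry hv
  exact ((h.comp (((measurable_fst.comp measurable_fst).add measurable_snd).prodMk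
    (measurable_snd.comp measurable_fst))).sub (h.comp measurable_fst)).enorm

/-- Tonelli for the time-averaged increment after time `r`. -/
lemma lintegral_lintegral_increment (hμ : X.IsInvariant μ) (hv : Measurable v) {r : ℝ}
    (hr : 0 ≤ r) (τ : ℝ) :
    ∫⁻ ω, (∫⁻ s in Set.Ioc 0 τ, ‖v (X.Z (r + s).toNNReal ω) - v (X.Z r.toNNReal ω)‖ₑ)
        / ENNReal.ofReal τ ∂(X.lawFrom μ) = X.oscillation μ v τ := by
  have hm := X.measurable_enorm_increment hv
  simp_rw [div_eq_mul_inv]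
  have hm1 : Measurable fun p : W × ℝ =>
      ‖v (X.Z (r + p.2).toNNReal p.1) - v (X.Z r.toNNReal p.1)‖ₑ :=
    hm.comp ((measurable_const.prodMk measurable_fst).prodMk measurable_snd)
  rw [lintegral_mul_const _ hm1.lintegral_prod_right', oscillation, div_eq_mul_inv,
    lintegral_lintegral_swap hm1.aemeasurable]
  congr 1
  exact setLIntegral_congr_fun measurableSet_Ioc fun s hs =>
    X.lintegral_enorm_increment hμ hv hr hs.1.le

/-- Continuity in probability of the stationary process, in averaged form. It needs no regularity
of the paths: by stationarity the average may be taken also over the starting time, and almost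
every time is a Lebesgue point of a given bounded measurable path. -/
lemma tendsto_oscillation (hμ : X.IsInvariant μ) (hv : Measurable v) (hK : ∀ z, |v z| ≤ K) :
    Tendsto (X.oscillation μ v) (𝓝[>] 0) (𝓝 0) := by
  obtain ⟨A, hA⟩ : ∃ A : ℝ → ℝ → W → ℝ≥0∞, ∀ τ r ω, A τ r ω =
    (∫⁻ s in Set.Ioc 0 τ, ‖v (X.Z (r + s).toNNReal ω) - v (X.Z r.toNNReal ω)‖ₑ)
      / ENNReal.ofReal τ := ⟨_, fun _ _ _ => rfl⟩
  have hAm : ∀ τ, Measurable fun p : ℝ × W => A τ p.1 p.2 := by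
    intro τ
    simp_rw [hA]
    exact (X.measurable_enorm_increment hv).lintegral_prod_right'.div_const _
  have hbound : ∀ τ r ω, 0 < τ → A τ r ω ≤ ENNReal.ofReal (2 * K) := by
    intro τ r ω hτ
    rw [hA]
    refine ENNReal.div_le_of_le_mul ?_
    calc _ ≤ ∫⁻ _ in Set.Ioc 0 τ, ENNReal.ofReal (2 * K) := by
          refine lintegral_mono fun s => ?_
          rw [← ofReal_norm, Real.norm_eq_abs]
          refine ENNReal.ofReal_le_ofReal ((abs_sub _ _).trans ?_)
          linarith [hK (X.Z (r + s).toNNReal ω), hK (X.Z r.toNNReal ω)]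
      _ = _ := by simp
  have hpos : ∀ᶠ τ : ℝ in 𝓝[>] 0, 0 < τ := self_mem_nhdsWithin
  have hpt : ∀ ω, ∀ᵐ r, Tendsto (fun τ => A τ r ω) (𝓝[>] 0) (𝓝 0) := by
    intro ω
    simp_rw [hA]
    exact ae_tendsto_lintegral_enorm_add_sub (x := fun s => v (X.Z s.toNNReal ω)) (K := K)
      (X.measurable_comp_Z_path hv ω) fun s => hK _
  have hin : ∀ ω, Tendsto (fun τ => ∫⁻ r in Set.Ioc (0 : ℝ) 1, A τ r ω) (𝓝[>] 0) (𝓝 0) := by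
    intro ω
    have := tendsto_lintegral_filter_of_dominated_convergence (l := 𝓝[>] (0 : ℝ))
      (μ := volume.restrict (Set.Ioc (0 : ℝ) 1)) (F := fun τ r => A τ r ω) (f := fun _ => 0)
      (fun _ => ENNReal.ofReal (2 * K))
      (Eventually.of_forall fun τ => (hAm τ).comp measurable_prodMk_right)
      (hpos.mono fun τ hτ => ae_of_all _ fun r => hbound τ r ω hτ)
      (by simp [ENNReal.mul_eq_top])
      (ae_restrict_of_ae (hpt ω))
    simpa using this
  have hout := tendsto_lintegral_filter_of_dominated_convergence (l := 𝓝[>] (0 : ℝ))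
      (μ := X.lawFrom μ) (F := fun τ ω => ∫⁻ r in Set.Ioc (0 : ℝ) 1, A τ r ω) (f := fun _ => 0)
      (fun _ => ENNReal.ofReal (2 * K))
      (Eventually.of_forall fun τ => (hAm τ).lintegral_prod_left')
      (hpos.mono fun τ hτ => ae_of_all _ fun ω =>
        (lintegral_mono fun r => hbound τ r ω hτ).trans (by simp))
      (by simp [ENNReal.mul_eq_top])
      (ae_of_all _ hin)
  simp only [lintegral_zero] at hout
  refine hout.congr fun τ => ?_
  have hswap : Measurable (Function.uncurry fun ω r => A τ r ω) := (hAm τ).comp measurable_swap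
  rw [lintegral_lintegral_swap hswap.aemeasurable,
    setLIntegral_congr_fun (g := fun _ => X.oscillation μ v τ) measurableSet_Ioc fun r hr => by
      simpa only [hA] using X.lintegral_lintegral_increment hμ hv hr.1.le τ]
  simp

/-- Short-time averages along the stationary process converge in `L¹` to the starting value. -/
lemma lintegral_enorm_average_sub_le (hμ : X.IsInvariant μ) (hv : Measurable v)
    (hK : ∀ z, |v z| ≤ K) {r τ : ℝ} (hr : 0 ≤ r) (hτ : 0 < τ) :
    ∫⁻ ω, ‖τ⁻¹ * X.pathIntegral v r (r + τ) ω - v (X.Z r.toNNReal ω)‖ₑ ∂(X.lawFrom μ)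
      ≤ X.oscillation μ v τ := by
  rw [← X.lintegral_lintegral_increment hμ hv hr τ]
  refine lintegral_mono fun ω => ?_
  have e : τ⁻¹ * X.pathIntegral v r (r + τ) ω - v (X.Z r.toNNReal ω)
      = τ⁻¹ * ∫ s in Set.Ioc 0 τ, (v (X.Z (r + s).toNNReal ω) - v (X.Z r.toNNReal ω)) := by
    have h1 := intervalIntegral.integral_comp_add_left (a := 0) (b := τ)
      (fun s => v (X.Z s.toNNReal ω)) r
    rw [add_zero] at h1
    have h2 : IntegrableOn (fun s => v (X.Z (r + s).toNNReal ω)) (Set.Ioc 0 τ) :=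
      Measure.integrableOn_of_bounded (M := K) (by simp)
        ((X.measurable_comp_Z_path hv ω).comp (measurable_const_add r)).aestronglyMeasurable
        (ae_of_all _ fun s => hK _)
    rw [pathIntegral, ← h1, intervalIntegral.integral_of_le hτ.le,
      integral_sub h2 (by simp), mul_sub]
    simp [hτ.le, hτ.ne']
  rw [e, enorm_mul, div_eq_mul_inv, mul_comm, enorm_inv hτ.ne', Real.enorm_of_nonneg hτ.le]
  gcongr
  exact enorm_integral_le_lintegral_enorm _

end MarkovProcess

/-! ### The generator on Feynman–Kac functions -/

lemma abs_inv_mul_exp_add_sub_le {I a b τ B : ℝ} (hτ : 0 < τ) (ha : |a| ≤ 1) (hI : I ≤ B) :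
    |τ⁻¹ * (Real.exp (I + a) - Real.exp I) - Real.exp I * b|
      ≤ Real.exp B * (τ⁻¹ * a ^ 2 + |τ⁻¹ * a - b|) := by
  have e : τ⁻¹ * (Real.exp (I + a) - Real.exp I) - Real.exp I * b
      = Real.exp I * (τ⁻¹ * (Real.exp a - 1 - a) + (τ⁻¹ * a - b)) := by
    rw [Real.exp_add]; ring
  rw [e, abs_mul, abs_of_pos (Real.exp_pos _)]
  refine mul_le_mul (Real.exp_le_exp.2 hI) ?_ (abs_nonneg _) (Real.exp_pos _).le
  refine (abs_add_le _ _).trans ?_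
  rw [abs_mul, abs_of_pos (inv_pos.2 hτ)]
  gcongr
  exact Real.abs_exp_sub_one_sub_id_le ha

/-- For uniformly bounded functions, convergence to `0` in `L¹` implies convergence in `L²`. -/
lemma eLpNorm_two_le_of_abs_le {α : Type*} [MeasurableSpace α] {μ : Measure α} {f : α → ℝ} {C : ℝ}
    (hf : ∀ z, |f z| ≤ C) :
    eLpNorm f 2 μ ≤ (ENNReal.ofReal C * ∫⁻ z, ‖f z‖ₑ ∂μ) ^ (1 / 2 : ℝ) := by
  rw [eLpNorm_eq_lintegral_rpow_enorm_toReal (by simp) (by simp)]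
  simp only [ENNReal.toReal_ofNat]
  gcongr
  rw [← lintegral_const_mul' _ _ ENNReal.ofReal_ne_top]
  refine lintegral_mono fun z => ?_
  have : ‖f z‖ₑ ^ (2 : ℝ) = ‖f z‖ₑ * ‖f z‖ₑ := by
    rw [show (2 : ℝ) = ((2 : ℕ) : ℝ) by norm_num, ENNReal.rpow_natCast, sq]
  rw [this]
  gcongr
  rw [← ofReal_norm, Real.norm_eq_abs]
  exact ENNReal.ofReal_le_ofReal (hf z)

lemma integral_const_mul_sub_sub {α : Type*} [MeasurableSpace α] {μ : Measure α} {F G H : α → ℝ}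
    (hF : Integrable F μ) (hG : Integrable G μ) (hH : Integrable H μ) (c : ℝ) :
    ∫ x, (c * (F x - G x) - H x) ∂μ = c * (∫ x, F x ∂μ - ∫ x, G x ∂μ) - ∫ x, H x ∂μ := by
  have h : Integrable (fun x => c * (F x - G x)) μ := (hF.sub hG).const_mul c
  rw [integral_sub h hH, integral_const_mul, integral_sub hF hG]

namespace MarkovProcess

variable {Ω W : Type*} [MeasurableSpace Ω] [MeasurableSpace W]

variable (X : MarkovProcess Ω W) {v : Ω → ℝ} {K : ℝ} {μ : Measure Ω}

/-- Stationarity of the exponential of a path integral. -/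
lemma integral_exp_pathIntegral_shift (hμ : X.IsInvariant μ) (hv : Measurable v)
    (hK : ∀ z, |v z| ≤ K) (τ : ℝ≥0) {r : ℝ} (hr : 0 ≤ r) :
    ∫ ω, Real.exp (X.pathIntegral v τ (τ + r) ω) ∂(X.lawFrom μ)
      = ∫ ω, Real.exp (X.pathIntegral v 0 r ω) ∂(X.lawFrom μ) := by
  have hm := fun a b => (X.measurable_pathIntegral hv a b).exp
  rw [integral_eq_lintegral_of_nonneg_ae (ae_of_all _ fun ω => (Real.exp_pos _).le)
      (hm _ _).aestronglyMeasurable,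
    integral_eq_lintegral_of_nonneg_ae (ae_of_all _ fun ω => (Real.exp_pos _).le)
      (hm _ _).aestronglyMeasurable,
    X.lintegral_lawFrom μ (hm _ _).ennreal_ofReal, X.lintegral_lawFrom μ (hm _ _).ennreal_ofReal]
  have hfk : Measurable fun z => ENNReal.ofReal (X.feynmanKac v r z) :=
    (X.stronglyMeasurable_feynmanKac hv r).measurable.ennreal_ofReal
  simp_rw [X.lintegral_exp_pathIntegral_shift hv hK τ hr, ← X.ofReal_feynmanKac hv hK,
    ← X.lintegral_transition τ _ hfk]
  rw [← Measure.lintegral_bind (X.transition τ).measurable.aemeasurable hfk.aemeasurable,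
    (hμ τ).def]

variable [IsProbabilityMeasure μ]

/-- The function `z ↦ E_z[exp(∫_0^r v(Z_s) ds) (v(Z_r) - v(Z_0))]`, which is the image of
`feynmanKac v r` under the generator: the two terms are the time derivative of the Feynman–Kac
function and the potential `v` times that function. -/
noncomputable def feynmanKacGenerator (X : MarkovProcess Ω W) (v : Ω → ℝ) (r : ℝ) (z : Ω) : ℝ :=
  ∫ ω, Real.exp (X.pathIntegral v 0 r ω) * (v (X.Z r.toNNReal ω) - v (X.Z 0 ω)) ∂(X.law z)

lemma measurable_comp_Z (hv : Measurable v) (s : ℝ≥0) : Measurable fun ω => v (X.Z s ω) :=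
  hv.comp (X.measurable_Z_time s)

lemma integrable_exp_mul (hv : Measurable v) (hK : ∀ z, |v z| ≤ K) (r : ℝ) {b : W → ℝ}
    (hb : Measurable b) {C : ℝ} (hbC : ∀ ω, |b ω| ≤ C) (P : Measure W) [IsFiniteMeasure P] :
    Integrable (fun ω => Real.exp (X.pathIntegral v 0 r ω) * b ω) P :=
  (X.integrable_exp_pathIntegral hv hK 0 r P).mul_bdd (c := C) hb.aestronglyMeasurable
    (ae_of_all _ fun ω => hbC ω)

lemma abs_increment_le (hK : ∀ z, |v z| ≤ K) (r : ℝ) (ω : W) :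
    |v (X.Z r.toNNReal ω) - v (X.Z 0 ω)| ≤ 2 * K := by
  refine (abs_sub _ _).trans ?_
  linarith [hK (X.Z r.toNNReal ω), hK (X.Z 0 ω)]

lemma integrable_exp_mul_increment (hv : Measurable v) (hK : ∀ z, |v z| ≤ K) (r : ℝ)
    (P : Measure W) [IsFiniteMeasure P] :
    Integrable (fun ω => Real.exp (X.pathIntegral v 0 r ω) *
      (v (X.Z r.toNNReal ω) - v (X.Z 0 ω))) P :=
  X.integrable_exp_mul hv hK r ((X.measurable_comp_Z hv _).sub (X.measurable_comp_Z hv _))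
    (X.abs_increment_le hK r) P

lemma stronglyMeasurable_feynmanKacGenerator (hv : Measurable v) (r : ℝ) :
    StronglyMeasurable (X.feynmanKacGenerator v r) :=
  ((X.measurable_pathIntegral hv 0 r).exp.mul ((X.measurable_comp_Z hv _).sub
    (X.measurable_comp_Z hv _))).stronglyMeasurable.integral_kernel

/-- The pointwise bound behind the moment estimate: positivity of the exponential weight turns
`|v(Z_r) - v(Z_0)| ≤ 2 K` into a bound by the Feynman–Kac function itself. -/
lemma abs_feynmanKacGenerator_le (hv : Measurable v) (hK : ∀ z, |v z| ≤ K) (r : ℝ) (z : Ω) :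
    |X.feynmanKacGenerator v r z| ≤ 2 * K * X.feynmanKac v r z := by
  unfold feynmanKacGenerator feynmanKac
  rw [← Real.norm_eq_abs, ← integral_const_mul]
  refine norm_integral_le_of_norm_le ((X.integrable_exp_pathIntegral hv hK 0 r _).const_mul _)
    (ae_of_all _ fun ω => ?_)
  rw [norm_mul, Real.norm_eq_abs, Real.norm_eq_abs, abs_of_pos (Real.exp_pos _), mul_comm]
  gcongr
  exact X.abs_increment_le hK r ω

lemma pathIntegral_le (hK : ∀ z, |v z| ≤ K) {r : ℝ} (hr : 0 ≤ r) (ω : W) :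
    X.pathIntegral v 0 r ω ≤ K * r := by
  have := (le_abs_self _).trans (X.abs_pathIntegral_le hK 0 r ω)
  rwa [sub_zero, abs_of_nonneg hr] at this

/-- Linearization of the exponential in a small increment `a` of the path integral, in `L¹`. -/
lemma lintegral_enorm_exp_increment_le (hK : ∀ z, |v z| ≤ K) {r τ : ℝ}
    (hr : 0 ≤ r) (hτ : 0 < τ) (hτK : 2 * K * τ ≤ 1) {a b : W → ℝ}
    (ha : ∀ ω, |a ω| ≤ 2 * K * τ) (P : Measure W) [IsProbabilityMeasure P] :
    ∫⁻ ω, ‖τ⁻¹ * (Real.exp (X.pathIntegral v 0 r ω + a ω) - Real.exp (X.pathIntegral v 0 r ω))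
        - Real.exp (X.pathIntegral v 0 r ω) * b ω‖ₑ ∂P
      ≤ ENNReal.ofReal (Real.exp (K * r)) *
        (ENNReal.ofReal (4 * K ^ 2 * τ) + ∫⁻ ω, ‖τ⁻¹ * a ω - b ω‖ₑ ∂P) := by
  have h1 : ENNReal.ofReal (4 * K ^ 2 * τ) + ∫⁻ ω, ‖τ⁻¹ * a ω - b ω‖ₑ ∂P
      = ∫⁻ ω, (ENNReal.ofReal (4 * K ^ 2 * τ) + ‖τ⁻¹ * a ω - b ω‖ₑ) ∂P := by
    rw [lintegral_add_left measurable_const]; simp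
  rw [h1, ← lintegral_const_mul' _ _ ENNReal.ofReal_ne_top]
  refine lintegral_mono fun ω => ?_
  have h2 := abs_inv_mul_exp_add_sub_le (b := b ω) hτ ((ha ω).trans hτK)
    (X.pathIntegral_le hK hr ω)
  have h3 : τ⁻¹ * a ω ^ 2 ≤ 4 * K ^ 2 * τ := by
    rw [inv_mul_le_iff₀ hτ, ← sq_abs]
    calc |a ω| ^ 2 ≤ (2 * K * τ) ^ 2 := by gcongr; exact ha ω
      _ = _ := by ring
  simp only [← ofReal_norm, Real.norm_eq_abs]
  rw [← ENNReal.ofReal_add (by positivity) (abs_nonneg _), ← ENNReal.ofReal_mul (by positivity)]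
  refine ENNReal.ofReal_le_ofReal (h2.trans ?_)
  gcongr

/-- Shifting the time window `[0, r]` by `τ` exchanges a piece of length `τ` at each end. -/
lemma pathIntegral_shift_eq (hv : Measurable v) (hK : ∀ z, |v z| ≤ K) (r τ : ℝ) (ω : W) :
    X.pathIntegral v τ (τ + r) ω = X.pathIntegral v 0 r ω
      + (X.pathIntegral v r (r + τ) ω - X.pathIntegral v 0 τ ω) := by
  have h1 := X.pathIntegral_add hv hK 0 τ (τ + r) ω
  have h2 := X.pathIntegral_add hv hK 0 r (r + τ) ω
  rw [add_comm r τ] at *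
  linarith

lemma abs_shift_le (hK : ∀ z, |v z| ≤ K) (r : ℝ) {τ : ℝ} (hτ : 0 < τ) (ω : W) :
    |X.pathIntegral v r (r + τ) ω - X.pathIntegral v 0 τ ω| ≤ 2 * K * τ := by
  have h1 := X.abs_pathIntegral_le hK r (r + τ) ω
  have h2 := X.abs_pathIntegral_le hK 0 τ ω
  rw [add_sub_cancel_left, abs_of_pos hτ] at h1
  rw [sub_zero, abs_of_pos hτ] at h2
  exact (abs_sub _ _).trans (by linarith)

/-- An upper bound for the `L¹` distance of difference quotients at step `τ` from their limits. -/
noncomputable def quotientError (X : MarkovProcess Ω W) (μ : Measure Ω) (v : Ω → ℝ) (K r τ : ℝ) :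
    ℝ≥0∞ :=
  ENNReal.ofReal (Real.exp (K * r)) *
    (ENNReal.ofReal (4 * K ^ 2 * τ) + 2 * X.oscillation μ v τ)

lemma tendsto_quotientError (hμ : X.IsInvariant μ) (hv : Measurable v) (hK : ∀ z, |v z| ≤ K)
    (r : ℝ) : Tendsto (X.quotientError μ v K r) (𝓝[>] 0) (𝓝 0) := by
  have h1 : Tendsto (fun τ : ℝ => ENNReal.ofReal (4 * K ^ 2 * τ)) (𝓝[>] 0) (𝓝 0) := by
    have : Continuous fun τ : ℝ => ENNReal.ofReal (4 * K ^ 2 * τ) :=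
      ENNReal.continuous_ofReal.comp (by fun_prop)
    simpa using (this.tendsto 0).mono_left nhdsWithin_le_nhds
  have h2 := ENNReal.Tendsto.const_mul (a := 2) (X.tendsto_oscillation hμ hv hK) (by simp)
  have h3 := ENNReal.Tendsto.const_mul (a := ENNReal.ofReal (Real.exp (K * r))) (h1.add h2)
    (by simp)
  simp only [mul_zero, add_zero] at h3
  exact h3

/-- The error in the difference quotient that defines the generator. -/
lemma lintegral_enorm_generator_error_le (hμ : X.IsInvariant μ) (hv : Measurable v)
    (hK : ∀ z, |v z| ≤ K) {r τ : ℝ} (hr : 0 ≤ r) (hτ : 0 < τ) (hτK : 2 * K * τ ≤ 1) :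
    ∫⁻ ω, ‖τ⁻¹ * (Real.exp (X.pathIntegral v τ (τ + r) ω) - Real.exp (X.pathIntegral v 0 r ω))
        - Real.exp (X.pathIntegral v 0 r ω) * (v (X.Z r.toNNReal ω) - v (X.Z 0 ω))‖ₑ
        ∂(X.lawFrom μ) ≤ X.quotientError μ v K r τ := by
  simp_rw [X.pathIntegral_shift_eq hv hK r τ]
  refine (X.lintegral_enorm_exp_increment_le hK hr hτ hτK (X.abs_shift_le hK r hτ) _).trans ?_
  unfold quotientError
  gcongr
  have hm : Measurable fun ω =>
      ‖τ⁻¹ * X.pathIntegral v r (r + τ) ω - v (X.Z r.toNNReal ω)‖ₑ :=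
    (((X.measurable_pathIntegral hv _ _).const_mul _).sub (X.measurable_comp_Z hv _)).enorm
  have h1 := X.lintegral_enorm_average_sub_le hμ hv hK hr hτ
  have h2 := X.lintegral_enorm_average_sub_le hμ hv hK le_rfl hτ
  rw [zero_add, Real.toNNReal_zero] at h2
  rw [two_mul]
  refine le_trans ?_ (add_le_add h1 h2)
  rw [← lintegral_add_left hm]
  refine lintegral_mono fun ω => ?_
  refine le_trans (le_of_eq ?_) enorm_sub_le
  congr 1
  ring

/-- The error in the right difference quotient of `r ↦ E_μ[exp ∫_0^r v(Z_s) ds]`. -/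
lemma lintegral_enorm_deriv_error_le (hμ : X.IsInvariant μ) (hv : Measurable v) (hK0 : 0 ≤ K)
    (hK : ∀ z, |v z| ≤ K) {r τ : ℝ} (hr : 0 ≤ r) (hτ : 0 < τ) (hτK : 2 * K * τ ≤ 1) :
    ∫⁻ ω, ‖τ⁻¹ * (Real.exp (X.pathIntegral v 0 (r + τ) ω) - Real.exp (X.pathIntegral v 0 r ω))
        - Real.exp (X.pathIntegral v 0 r ω) * v (X.Z r.toNNReal ω)‖ₑ ∂(X.lawFrom μ)
      ≤ X.quotientError μ v K r τ := by
  simp_rw [← X.pathIntegral_add hv hK 0 r (r + τ)]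
  refine (X.lintegral_enorm_exp_increment_le hK hr hτ hτK (fun ω => ?_) _).trans ?_
  · have h1 := X.abs_pathIntegral_le hK r (r + τ) ω
    rw [add_sub_cancel_left, abs_of_pos hτ] at h1
    nlinarith
  · unfold quotientError
    gcongr
    refine (X.lintegral_enorm_average_sub_le hμ hv hK hr hτ).trans ?_
    rw [two_mul]
    exact le_self_add

lemma eventually_small (K : ℝ) : ∀ᶠ τ : ℝ in 𝓝[>] 0, 0 < τ ∧ 2 * K * τ ≤ 1 := by
  have h : ∀ᶠ τ : ℝ in 𝓝 0, 2 * K * τ < 1 := by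
    have : Continuous fun τ : ℝ => 2 * K * τ := by fun_prop
    exact (this.tendsto 0).eventually (gt_mem_nhds (by simp))
  filter_upwards [self_mem_nhdsWithin, nhdsWithin_le_nhds h] with τ h1 h2 using ⟨h1, h2.le⟩

lemma generator_quotient_eq (hv : Measurable v) (hK : ∀ z, |v z| ≤ K) {r : ℝ} (hr : 0 ≤ r)
    (τ : ℝ≥0) (z : Ω) :
    (τ : ℝ)⁻¹ * (X.semigroup τ (X.feynmanKac v r) z - X.feynmanKac v r z)
        - X.feynmanKacGenerator v r z
      = ∫ ω, ((τ : ℝ)⁻¹ * (Real.exp (X.pathIntegral v τ (τ + r) ω)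
          - Real.exp (X.pathIntegral v 0 r ω))
        - Real.exp (X.pathIntegral v 0 r ω) * (v (X.Z r.toNNReal ω) - v (X.Z 0 ω))) ∂(X.law z) := by
  have h1 := X.integrable_exp_pathIntegral hv hK τ (τ + r) (X.law z)
  have h2 := X.integrable_exp_pathIntegral hv hK 0 r (X.law z)
  rw [integral_const_mul_sub_sub h1 h2 (X.integrable_exp_mul_increment hv hK r _), X.semigroup_feynmanKac hv hK τ hr]
  rfl

/-- The Feynman–Kac functions belong to the domain of the generator on `L²(μ)`. -/
lemma isGenerator_feynmanKac (hμ : X.IsInvariant μ) (hv : Measurable v) (hK0 : 0 ≤ K)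
    (hK : ∀ z, |v z| ≤ K) {r : ℝ} (hr : 0 ≤ r) :
    X.IsGenerator μ (X.feynmanKac v r) (X.feynmanKacGenerator v r) := by
  have hu := X.feynmanKac_le hv hK r
  refine ⟨MemLp.of_bound (X.stronglyMeasurable_feynmanKac hv r).aestronglyMeasurable
      (Real.exp (K * |r|)) (ae_of_all _ fun z => ?_),
    MemLp.of_bound (X.stronglyMeasurable_feynmanKacGenerator hv r).aestronglyMeasurable
      (2 * K * Real.exp (K * |r|)) (ae_of_all _ fun z => ?_), ?_⟩
  · rw [Real.norm_eq_abs, abs_of_nonneg (X.feynmanKac_nonneg r z)]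
    exact hu z
  · refine (X.abs_feynmanKacGenerator_le hv hK r z).trans ?_
    gcongr
    exact hu z
  have hcoe : Tendsto (fun τ : ℝ≥0 => (τ : ℝ)) (𝓝[>] 0) (𝓝[>] 0) := by
    refine tendsto_nhdsWithin_iff.2 ⟨?_, ?_⟩
    · exact (NNReal.continuous_coe.tendsto 0).mono_left nhdsWithin_le_nhds
    · filter_upwards [self_mem_nhdsWithin] with τ hτ
      exact NNReal.coe_pos.2 hτ
  set C := Real.exp (K * r) * (2 * K + 4 * K) with hC
  have hlim : Tendsto (fun τ : ℝ≥0 =>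
      (ENNReal.ofReal C * X.quotientError μ v K r τ) ^ (1 / 2 : ℝ)) (𝓝[>] 0) (𝓝 0) := by
    have h1 := ENNReal.Tendsto.const_mul (a := ENNReal.ofReal C)
      ((X.tendsto_quotientError hμ hv hK r).comp hcoe) (by simp)
    rw [mul_zero] at h1
    simpa using h1.ennrpow_const (1 / 2 : ℝ)
  refine tendsto_of_tendsto_of_tendsto_of_le_of_le' tendsto_const_nhds hlim
    (Eventually.of_forall fun _ => zero_le) ?_
  filter_upwards [hcoe.eventually (eventually_small K)] with τ hτ
  obtain ⟨hτ0, hτK⟩ := hτ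
  simp_rw [X.generator_quotient_eq hv hK hr τ]
  refine (eLpNorm_two_le_of_abs_le (C := C) fun z => ?_).trans ?_
  · have := norm_integral_le_of_norm_le_const (μ := X.law z) (C := C)
      (f := fun ω => (τ : ℝ)⁻¹ * (Real.exp (X.pathIntegral v τ (τ + r) ω)
          - Real.exp (X.pathIntegral v 0 r ω))
        - Real.exp (X.pathIntegral v 0 r ω) * (v (X.Z r.toNNReal ω) - v (X.Z 0 ω)))
      (ae_of_all _ fun ω => by
        have ha := X.abs_shift_le hK r hτ0 ω
        rw [X.pathIntegral_shift_eq hv hK r τ, Real.norm_eq_abs]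
        refine (abs_inv_mul_exp_add_sub_le hτ0 (ha.trans hτK)
          (X.pathIntegral_le hK hr ω)).trans ?_
        rw [hC]
        refine mul_le_mul_of_nonneg_left (add_le_add ?_ ?_) (Real.exp_pos _).le
        · rw [inv_mul_le_iff₀ hτ0, ← sq_abs, sq]
          calc _ ≤ 2 * K * τ * 1 := by gcongr; exact ha.trans hτK
            _ = _ := by ring
        · refine (abs_sub _ _).trans ?_
          have h1 : |(τ : ℝ)⁻¹ * (X.pathIntegral v r (r + τ) ω - X.pathIntegral v 0 τ ω)|
              ≤ 2 * K := by
            rw [abs_mul, abs_of_pos (inv_pos.2 hτ0), inv_mul_le_iff₀ hτ0]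
            linarith
          linarith [X.abs_increment_le hK r ω])
    simpa using this
  · gcongr
    refine le_trans ?_ (X.lintegral_enorm_generator_error_le hμ hv hK hr hτ0 hτK)
    rw [X.lintegral_lawFrom]
    · exact lintegral_mono fun z => enorm_integral_le_lintegral_enorm _
    · exact ((((X.measurable_pathIntegral hv _ _).exp.sub
        (X.measurable_pathIntegral hv _ _).exp).const_mul _).sub
        ((X.measurable_pathIntegral hv _ _).exp.mul ((X.measurable_comp_Z hv _).sub
          (X.measurable_comp_Z hv _)))).enorm

/-- The generator has mean zero on Feynman–Kac functions. -/
lemma integral_exp_mul_increment (hμ : X.IsInvariant μ) (hv : Measurable v)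
    (hK : ∀ z, |v z| ≤ K) {r : ℝ} (hr : 0 ≤ r) :
    ∫ ω, Real.exp (X.pathIntegral v 0 r ω) * (v (X.Z r.toNNReal ω) - v (X.Z 0 ω)) ∂(X.lawFrom μ)
      = 0 := by
  rw [← enorm_eq_zero, ← nonpos_iff_eq_zero]
  refine ge_of_tendsto (X.tendsto_quotientError hμ hv hK r) ?_
  filter_upwards [eventually_small K] with τ hτ
  refine le_trans ?_ (X.lintegral_enorm_generator_error_le hμ hv hK hr hτ.1 hτ.2)
  refine le_trans (le_of_eq ?_) (enorm_integral_le_lintegral_enorm _)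
  have h1 := X.integrable_exp_pathIntegral hv hK τ (τ + r) (X.lawFrom μ)
  have h2 := X.integrable_exp_pathIntegral hv hK 0 r (X.lawFrom μ)
  have h3 := X.integral_exp_pathIntegral_shift hμ hv hK τ.toNNReal hr
  rw [Real.coe_toNNReal τ hτ.1.le] at h3
  rw [integral_const_mul_sub_sub h1 h2 (X.integrable_exp_mul_increment hv hK r _), h3, sub_self, mul_zero, zero_sub, enorm_neg]

lemma integral_exp_mul_start (hv : Measurable v) (hK : ∀ z, |v z| ≤ K) (r : ℝ) :
    ∫ ω, Real.exp (X.pathIntegral v 0 r ω) * v (X.Z 0 ω) ∂(X.lawFrom μ)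
      = ∫ z, v z * X.feynmanKac v r z ∂μ := by
  rw [X.integral_lawFrom μ (X.integrable_exp_mul hv hK r (X.measurable_comp_Z hv 0)
    (fun ω => hK _) _)]
  refine integral_congr_ae (ae_of_all _ fun z => ?_)
  simp only
  rw [feynmanKac, ← integral_const_mul]
  refine integral_congr_ae ((X.start z).mono fun ω hω => ?_)
  simp only
  rw [hω, mul_comm]

/-- The right derivative of `r ↦ E_μ[exp ∫_0^r v(Z_s) ds]` is `∫ v (feynmanKac v r) dμ`. -/
lemma tendsto_slope_mean (hμ : X.IsInvariant μ) (hv : Measurable v) (hK0 : 0 ≤ K)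
    (hK : ∀ z, |v z| ≤ K) {r : ℝ} (hr : 0 ≤ r) :
    Tendsto (fun τ : ℝ => τ⁻¹ * (∫ ω, Real.exp (X.pathIntegral v 0 (r + τ) ω) ∂(X.lawFrom μ)
        - ∫ ω, Real.exp (X.pathIntegral v 0 r ω) ∂(X.lawFrom μ)))
      (𝓝[>] 0) (𝓝 (∫ z, v z * X.feynmanKac v r z ∂μ)) := by
  have hi0 := X.integrable_exp_mul hv hK r (X.measurable_comp_Z hv 0) (fun ω => hK _) (X.lawFrom μ)
  have hir := X.integrable_exp_mul hv hK r (X.measurable_comp_Z hv r.toNNReal) (fun ω => hK _)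
    (X.lawFrom μ)
  have h0 := X.integral_exp_mul_increment hμ hv hK hr
  simp_rw [mul_sub] at h0
  rw [integral_sub hir hi0, sub_eq_zero, X.integral_exp_mul_start hv hK] at h0
  rw [← h0, tendsto_iff_edist_tendsto_0]
  refine tendsto_of_tendsto_of_tendsto_of_le_of_le' tendsto_const_nhds
    (X.tendsto_quotientError hμ hv hK r) (Eventually.of_forall fun _ => zero_le) ?_
  filter_upwards [eventually_small K] with τ hτ
  refine le_trans ?_ (X.lintegral_enorm_deriv_error_le hμ hv hK0 hK hr hτ.1 hτ.2)
  refine le_trans (le_of_eq ?_) (enorm_integral_le_lintegral_enorm _)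
  have h1 := X.integrable_exp_pathIntegral hv hK 0 (r + τ) (X.lawFrom μ)
  have h2 := X.integrable_exp_pathIntegral hv hK 0 r (X.lawFrom μ)
  rw [edist_eq_enorm_sub, integral_const_mul_sub_sub h1 h2 hir]

end MarkovProcess

/-! ### Exponential moments and tail bounds -/

/-- The Cauchy–Schwarz inequality. -/
lemma sq_integral_mul_le {α : Type*} [MeasurableSpace α] {μ : Measure α} {f g : α → ℝ}
    (hf : MemLp f 2 μ) (hg : MemLp g 2 μ) :
    (∫ x, f x * g x ∂μ) ^ 2 ≤ (∫ x, f x ^ 2 ∂μ) * ∫ x, g x ^ 2 ∂μ := by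
  have h : ∀ c : ℝ, 0 ≤ (∫ x, f x ^ 2 ∂μ) * (c * c) + (2 * ∫ x, f x * g x ∂μ) * c
      + ∫ x, g x ^ 2 ∂μ := by
    intro c
    have hff := hf.integrable_sq
    have hgg := hg.integrable_sq
    have hfg : Integrable (fun x => f x * g x) μ := hf.integrable_mul hg
    have e : ∫ x, (c * f x + g x) ^ 2 ∂μ = (∫ x, f x ^ 2 ∂μ) * (c * c)
        + (2 * ∫ x, f x * g x ∂μ) * c + ∫ x, g x ^ 2 ∂μ := by
      have e1 : ∀ x, (c * f x + g x) ^ 2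
          = (c * c) * f x ^ 2 + (2 * c) * (f x * g x) + g x ^ 2 := fun x => by ring
      have h1 : Integrable (fun x => (c * c) * f x ^ 2 + (2 * c) * (f x * g x)) μ :=
        (hff.const_mul _).add (hfg.const_mul _)
      simp_rw [e1]
      rw [integral_add h1 hgg, integral_add (hff.const_mul _) (hfg.const_mul _), integral_const_mul, integral_const_mul]
      ring
    rw [← e]
    exact integral_nonneg fun x => sq_nonneg _
  have := discrim_le_zero h
  rw [discrim] at this
  linarith

namespace MarkovProcess

variable {Ω W : Type*} [MeasurableSpace Ω] [MeasurableSpace W]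

variable (X : MarkovProcess Ω W) {v f : Ω → ℝ} {K η ς : ℝ} {μ : Measure Ω}
  [IsProbabilityMeasure μ]

lemma integral_feynmanKac (hv : Measurable v) (hK : ∀ z, |v z| ≤ K) (r : ℝ) :
    ∫ z, X.feynmanKac v r z ∂μ = ∫ ω, Real.exp (X.pathIntegral v 0 r ω) ∂(X.lawFrom μ) :=
  (X.integral_lawFrom μ (X.integrable_exp_pathIntegral hv hK 0 r _)).symm

/-- The iterated Poincaré inequality makes the Feynman–Kac functions almost constant, hence almost
uncorrelated with the potential. -/
lemma integral_mul_feynmanKac_le (hμ : X.IsInvariant μ) (hη : X.HasIPGap μ η) (hv : Measurable v)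
    (hK0 : 0 ≤ K) (hK : ∀ z, |v z| ≤ K) (hmean : ∫ z, v z ∂μ = 0) (hς : 0 ≤ ς)
    (hvar : variance v μ ≤ ς ^ 2) (hKη : 2 * K < η) {r : ℝ} (hr : 0 ≤ r) :
    ∫ z, v z * X.feynmanKac v r z ∂μ
      ≤ ς * (2 * K / η / √(1 - (2 * K / η) ^ 2)) * ∫ z, X.feynmanKac v r z ∂μ := by
  have hη0 := hη.1
  have hgen := X.isGenerator_feynmanKac hμ hv hK0 hK hr
  set u := X.feynmanKac v r with hu
  set g := X.feynmanKacGenerator v r with hg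
  set m := ∫ z, u z ∂μ with hm
  set V := variance u μ with hV
  set x := 2 * K / η with hx
  have hx0 : 0 ≤ x := by positivity
  have hx1 : x < 1 := (div_lt_one hη0).2 hKη
  have hx2 : 0 < 1 - x ^ 2 := by nlinarith
  have hm0 : 0 ≤ m := integral_nonneg fun z => X.feynmanKac_nonneg r z
  have hu2 : MemLp u 2 μ := hgen.1
  have hVeq : V = ∫ z, u z ^ 2 ∂μ - m ^ 2 := variance_eq_sub hu2
  have hvL : MemLp v 2 μ := MemLp.of_bound hv.aestronglyMeasurable K (ae_of_all _ hK)
  have hg2 : ∫ z, g z ^ 2 ∂μ ≤ (2 * K) ^ 2 * ∫ z, u z ^ 2 ∂μ := by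
    rw [← integral_const_mul]
    refine integral_mono hgen.2.1.integrable_sq (hu2.integrable_sq.const_mul _) fun z => ?_
    simp only
    rw [← mul_pow, ← sq_abs]
    gcongr
    exact X.abs_feynmanKacGenerator_le hv hK r z
  have hVx : V * (1 - x ^ 2) ≤ x ^ 2 * m ^ 2 := by
    have h1 := hη.2 u g hgen
    have h2 : V ≤ x ^ 2 * ∫ z, u z ^ 2 ∂μ := by
      refine h1.trans ?_
      calc _ ≤ (η ^ 2)⁻¹ * ((2 * K) ^ 2 * ∫ z, u z ^ 2 ∂μ) := by gcongr
        _ = _ := by rw [hx]; field_simp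
    have h3 : ∫ z, u z ^ 2 ∂μ = V + m ^ 2 := by rw [hVeq]; ring
    rw [h3] at h2
    linarith
  have hcov : ∫ z, v z * u z ∂μ = ∫ z, v z * (u z - m) ∂μ := by
    simp_rw [mul_sub]
    have hvu : Integrable (fun z => v z * u z) μ := hvL.integrable_mul hu2
    rw [integral_sub hvu ((hvL.integrable (by norm_num)).mul_const m),
      integral_mul_const, hmean]
    simp
  have hw : MemLp (fun z => u z - m) 2 μ := hu2.sub (memLp_const m)
  have hcs := sq_integral_mul_le hvL hw
  have hv2 : ∫ z, v z ^ 2 ∂μ = variance v μ := by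
    rw [variance_eq_sub hvL, hmean]; simp
  have hw2 : ∫ z, (u z - m) ^ 2 ∂μ = V := (variance_eq_integral hu2.1.aemeasurable).symm
  rw [← hcov, hv2, hw2] at hcs
  refine (le_abs_self _).trans (abs_le_of_sq_le_sq ?_ (by positivity))
  rw [mul_pow, mul_pow, div_pow, Real.sq_sqrt hx2.le]
  refine hcs.trans ?_
  have h4 : V ≤ x ^ 2 * m ^ 2 / (1 - x ^ 2) := (le_div_iff₀ hx2).2 hVx
  calc _ ≤ ς ^ 2 * (x ^ 2 * m ^ 2 / (1 - x ^ 2)) :=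
        mul_le_mul hvar h4 (variance_nonneg _ _) (sq_nonneg _)
    _ = _ := by ring

/-- The exponential moment bound for the stationary process. -/
lemma integral_exp_pathIntegral_le (hμ : X.IsInvariant μ) (hη : X.HasIPGap μ η)
    (hv : Measurable v)
    (hK0 : 0 ≤ K) (hK : ∀ z, |v z| ≤ K) (hmean : ∫ z, v z ∂μ = 0) (hς : 0 ≤ ς)
    (hvar : variance v μ ≤ ς ^ 2) (hKη : 2 * K < η) {t : ℝ} (ht : 0 ≤ t) :
    ∫ ω, Real.exp (X.pathIntegral v 0 t ω) ∂(X.lawFrom μ)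
      ≤ Real.exp (ς * (2 * K / η / √(1 - (2 * K / η) ^ 2)) * t) := by
  set L := ς * (2 * K / η / √(1 - (2 * K / η) ^ 2)) with hL
  have hcont : ContinuousOn (fun r => ∫ ω, Real.exp (X.pathIntegral v 0 r ω) ∂(X.lawFrom μ))
      (Set.Icc 0 t) := by
    refine continuousOn_of_dominated (bound := fun _ => Real.exp (K * t))
      (fun r _ => (X.measurable_pathIntegral hv 0 r).exp.aestronglyMeasurable)
      (fun r hr => ae_of_all _ fun ω => ?_) (integrable_const _) (ae_of_all _ fun ω => ?_)
    · rw [Real.norm_eq_abs, Real.abs_exp]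
      refine Real.exp_le_exp.2 ((X.pathIntegral_le hK hr.1 ω).trans ?_)
      exact mul_le_mul_of_nonneg_left hr.2 hK0
    · exact (Real.continuous_exp.comp (intervalIntegral.continuous_primitive
        (fun a b => X.intervalIntegrable_comp_Z hv hK ω a b) 0)).continuousOn
  have h := le_gronwallBound_of_liminf_deriv_right_le (δ := 1) (K := L) (ε := 0)
    (f' := fun r => ∫ z, v z * X.feynmanKac v r z ∂μ) hcont ?_ ?_ ?_ t ⟨ht, le_rfl⟩
  · simpa [gronwallBound_ε0] using h
  · intro r hr c hc
    have h1 := X.tendsto_slope_mean hμ hv hK0 hK hr.1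
    have h2 : Tendsto (fun y : ℝ => y - r) (𝓝[>] r) (𝓝[>] 0) := by
      refine tendsto_nhdsWithin_iff.2 ⟨?_, ?_⟩
      · have : Tendsto (fun y : ℝ => y - r) (𝓝 r) (𝓝 (r - r)) :=
          (continuous_id.sub continuous_const).tendsto r
        rw [sub_self] at this
        exact this.mono_left nhdsWithin_le_nhds
      · filter_upwards [self_mem_nhdsWithin] with y hy
        simpa using hy
    refine (((h1.comp h2).eventually (gt_mem_nhds hc)).mono fun y hy => ?_).frequently
    simpa using hy
  · simp [pathIntegral]
  · intro r hr
    rw [add_zero, ← X.integral_feynmanKac hv hK]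
    exact X.integral_mul_feynmanKac_le hμ hη hv hK0 hK hmean hς hvar hKη hr.1

lemma pathIntegral_const_mul (c a b : ℝ) (ω : W) :
    X.pathIntegral (fun z => c * f z) a b ω = c * X.pathIntegral f a b ω :=
  intervalIntegral.integral_const_mul _ _

variable {M σ : ℝ}

/-- The one-sided tail bound for the stationary process. -/
lemma measureReal_le_pathIntegral_le (hμ : X.IsInvariant μ) (hη : X.HasIPGap μ η)
    (hf : Measurable f) (hM0 : 0 < M) (hM : ∀ z, |f z| ≤ M) (hmean : ∫ z, f z ∂μ = 0)
    (hσ0 : 0 < σ) (hσ : variance f μ ≤ σ ^ 2) {t δ : ℝ} (ht : 0 ≤ t) (hδ : 0 < δ) :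
    (X.lawFrom μ).real {ω | t * δ ≤ X.pathIntegral f 0 t ω}
      ≤ Real.exp (-(t * η * δ ^ 2 / (4 * M * √(4 * σ ^ 2 + δ ^ 2)))) := by
  have hη0 := hη.1
  set R := √(4 * σ ^ 2 + δ ^ 2) with hR
  have hR0 : 0 < R := Real.sqrt_pos.2 (by positivity)
  have hR2 : R ^ 2 = 4 * σ ^ 2 + δ ^ 2 := Real.sq_sqrt (by positivity)
  -- This `θ` makes `x = 2 θ M / η` the sine of the angle with tangent `δ / (2 σ)`; then
  -- `x / √(1 - x²) = δ / (2 σ)` and half of the Chernoff exponent `t θ δ` survives.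
  set θ := η * δ / (2 * M * R) with hθ
  have hθ0 : 0 < θ := by positivity
  have hx : 2 * (θ * M) / η = δ / R := by rw [hθ]; field_simp
  have hδR : δ < R := by
    refine lt_of_pow_lt_pow_left₀ 2 hR0.le ?_
    rw [hR2]; nlinarith
  have hroot : √(1 - (δ / R) ^ 2) = 2 * σ / R := by
    rw [show 1 - (δ / R) ^ 2 = (2 * σ / R) ^ 2 by field_simp; rw [hR2]; ring]
    exact Real.sqrt_sq (by positivity)
  have hmgf := X.integral_exp_pathIntegral_le (v := fun z => θ * f z) (K := θ * M) (ς := θ * σ)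
    hμ hη (hf.const_mul θ) (by positivity)
    (fun z => by rw [abs_mul, abs_of_pos hθ0]; exact mul_le_mul_of_nonneg_left (hM z) hθ0.le)
    (by rw [integral_const_mul, hmean, mul_zero]) (by positivity)
    (by rw [variance_const_mul, mul_pow]; gcongr)
    (by
      have : 2 * (θ * M) / η < 1 := by rw [hx]; exact (div_lt_one hR0).2 hδR
      rwa [div_lt_one hη0] at this) ht
  have hint := X.integrable_exp_pathIntegral (v := fun z => θ * f z) (K := θ * M)
    (hf.const_mul θ)
    (fun z => by rw [abs_mul, abs_of_pos hθ0]; exact mul_le_mul_of_nonneg_left (hM z) hθ0.le)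
    0 t (X.lawFrom μ)
  simp_rw [X.pathIntegral_const_mul] at hmgf hint
  refine (measure_ge_le_exp_mul_mgf (t * δ) hθ0.le hint).trans ?_
  calc Real.exp (-θ * (t * δ)) * mgf (X.pathIntegral f 0 t) (X.lawFrom μ) θ
      ≤ Real.exp (-θ * (t * δ)) *
          Real.exp (θ * σ * (2 * (θ * M) / η / √(1 - (2 * (θ * M) / η) ^ 2)) * t) := by
        gcongr; exact hmgf
    _ = _ := by
        rw [hx, hroot, ← Real.exp_add]
        congr 1
        rw [hθ]
        field_simp
        ring

/-- The two-sided tail bound for the stationary process. -/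
lemma measureReal_le_abs_timeAverage_le (hμ : X.IsInvariant μ) (hη : X.HasIPGap μ η)
    (hf : Measurable f) (hM0 : 0 < M) (hM : ∀ z, |f z| ≤ M) (hmean : ∫ z, f z ∂μ = 0)
    (hσ : variance f μ ≤ σ ^ 2) {t δ : ℝ} (ht : 0 < t) (hδ : 0 < δ) :
    (X.lawFrom μ).real {ω | δ ≤ |X.timeAverage f t ω|}
      ≤ 2 * Real.exp (-(t * η * δ ^ 2 / (4 * M * √(4 * σ ^ 2 + δ ^ 2)))) := by
  have hpos : ∀ s : ℝ, 0 < s → variance f μ ≤ s ^ 2 →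
      (X.lawFrom μ).real {ω | δ ≤ |X.timeAverage f t ω|}
        ≤ 2 * Real.exp (-(t * η * δ ^ 2 / (4 * M * √(4 * s ^ 2 + δ ^ 2)))) := by
    intro s hs0 hs
    have h1 := X.measureReal_le_pathIntegral_le hμ hη hf hM0 hM hmean hs0 hs ht.le hδ
    have h2 := X.measureReal_le_pathIntegral_le (f := fun z => -1 * f z) hμ hη (hf.const_mul _)
      hM0 (fun z => by rw [abs_mul]; simpa using hM z)
      (by rw [integral_const_mul, hmean, mul_zero]) hs0 (by rw [variance_const_mul]; simpa using hs)
      ht.le hδ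
    rw [two_mul]
    refine (measureReal_mono ?_).trans ((measureReal_union_le _ _).trans (add_le_add h1 h2))
    intro ω hω
    have hω' : δ ≤ |t⁻¹ * X.pathIntegral f 0 t ω| := hω
    rw [abs_mul, abs_of_pos (inv_pos.2 ht), le_inv_mul_iff₀ ht] at hω'
    rcases le_abs.1 hω' with h | h
    · exact Or.inl h
    · right
      simp only [Set.mem_ofPred_eq, X.pathIntegral_const_mul]
      linarith
  -- The case `σ = 0` is reached as a limit.
  have hlim : Tendsto (fun s : ℝ =>
      2 * Real.exp (-(t * η * δ ^ 2 / (4 * M * √(4 * s ^ 2 + δ ^ 2))))) (𝓝[>] |σ|)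
      (𝓝 (2 * Real.exp (-(t * η * δ ^ 2 / (4 * M * √(4 * |σ| ^ 2 + δ ^ 2)))))) := by
    have hc : Continuous fun s : ℝ =>
        2 * Real.exp (-(t * η * δ ^ 2 / (4 * M * √(4 * s ^ 2 + δ ^ 2)))) := by
      have : ∀ s : ℝ, 4 * M * √(4 * s ^ 2 + δ ^ 2) ≠ 0 := fun s => by positivity
      fun_prop (disch := exact this _)
    exact (hc.tendsto _).mono_left nhdsWithin_le_nhds
  rw [sq_abs] at hlim
  refine ge_of_tendsto hlim ?_
  filter_upwards [self_mem_nhdsWithin] with s hs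
  have hs' : |σ| < s := hs
  refine hpos s ((abs_nonneg σ).trans_lt hs') (hσ.trans ?_)
  rw [← sq_abs]
  gcongr

/-- Change of the initial distribution, by Hölder's inequality: a probability is at most `1`, so
its `q`-th power is at most the probability itself. -/
lemma lawFrom_le_eLpNorm_mul_rpow {ν : Measure Ω} [SigmaFinite ν] (hν : ν ≪ μ) {p q : ℝ≥0∞}
    (hpq : p.HolderConjugate q) {A : Set W} (hA : MeasurableSet A) :
    X.lawFrom ν A ≤ eLpNorm (ν.rnDeriv μ) p μ * (X.lawFrom μ A) ^ q⁻¹.toReal := by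
  have hh : Measurable fun z => X.law z A := X.law.measurable_coe hA
  have hr : Measurable (ν.rnDeriv μ) := Measure.measurable_rnDeriv ν μ
  rw [lawFrom, lawFrom, Measure.bind_apply hA X.law.measurable.aemeasurable,
    Measure.bind_apply hA X.law.measurable.aemeasurable,
    ← lintegral_rnDeriv_mul hν hh.aemeasurable]
  rcases eq_or_ne p ∞ with rfl | hp
  · have hq : q = 1 := by
      have := hpq.inv_add_inv_eq_one
      simpa using this
    subst hq
    simp only [inv_one, ENNReal.toReal_one, ENNReal.rpow_one, eLpNorm_exponent_top]
    rw [← lintegral_const_mul _ hh]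
    refine lintegral_mono_ae ?_
    filter_upwards [ae_le_eLpNormEssSup (f := ν.rnDeriv μ) (μ := μ)] with z hz
    gcongr
    simpa using hz
  rcases eq_or_ne q ∞ with rfl | hq
  · have hp1 : p = 1 := by
      have := hpq.inv_add_inv_eq_one
      simpa using this
    subst hp1
    simp only [ENNReal.inv_top, ENNReal.toReal_zero, ENNReal.rpow_zero, mul_one,
      eLpNorm_one_eq_lintegral_enorm, enorm_eq_self]
    exact lintegral_mono fun z => mul_le_of_le_one_right' prob_le_one
  have hc := ENNReal.HolderConjugate.toReal_of_ne_top hp hq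
  have hp0 : p ≠ 0 := hpq.ne_zero
  refine (ENNReal.lintegral_mul_le_Lp_mul_Lq μ hc hr.aemeasurable hh.aemeasurable).trans ?_
  rw [eLpNorm_eq_lintegral_rpow_enorm_toReal hp0 hp]
  simp only [enorm_eq_self]
  rw [ENNReal.toReal_inv, one_div q.toReal]
  gcongr with z
  · have := ENNReal.rpow_le_rpow_of_exponent_ge (x := X.law z A) prob_le_one hc.symm.lt.le
    simpa using this

lemma one_le_eLpNorm_rnDeriv {ν : Measure Ω} [IsProbabilityMeasure ν] (hν : ν ≪ μ) {p : ℝ≥0∞}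
    (hp : 1 ≤ p) : 1 ≤ eLpNorm (ν.rnDeriv μ) p μ := by
  refine le_trans (le_of_eq ?_) (eLpNorm_le_eLpNorm_of_exponent_le hp
    (Measure.measurable_rnDeriv ν μ).aestronglyMeasurable)
  rw [eLpNorm_one_eq_lintegral_enorm]
  simp only [enorm_eq_self]
  rw [Measure.lintegral_rnDeriv hν, measure_univ]

end MarkovProcess

theorem theorem3p4 {Ω W : Type*}
    [TopologicalSpace Ω] [PolishSpace Ω] [MeasurableSpace Ω] [BorelSpace Ω] [MeasurableSpace W]
    (X : MarkovProcess Ω W)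
    (μ : Measure Ω) [IsProbabilityMeasure μ] (hμ : X.IsInvariant μ)
    (η : ℝ) (hη : X.HasIPGap μ η)
    (ν : Measure Ω) [IsProbabilityMeasure ν] (hν : ν ≪ μ)
    (p q : ℝ≥0∞) (hpq : p.HolderConjugate q)
    (hp : eLpNorm (ν.rnDeriv μ) p μ < ∞)
    (f : Ω → ℝ) (hf : Measurable f) (M σ : ℝ)
    (hmean : ∫ z, f z ∂μ = 0) (hM : ∀ z, |f z| ≤ M) (hσ : variance f μ ≤ σ ^ 2)
    (t : ℝ) (ht : 0 ≤ t) (δ : ℝ) (hδ : 0 ≤ δ) :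
    (X.lawFrom ν).real {ω | δ ≤ |X.timeAverage f t ω|} ≤
      2 * (eLpNorm (ν.rnDeriv μ) p μ).toReal *
        Real.exp (-(q⁻¹.toReal * (t * η * δ ^ 2 / (4 * M * √(4 * σ ^ 2 + δ ^ 2))))) := by
  obtain ⟨z₀⟩ := nonempty_of_isProbabilityMeasure μ
  have hM0 : 0 ≤ M := (abs_nonneg _).trans (hM z₀)
  set N := eLpNorm (ν.rnDeriv μ) p μ with hN
  have hN1 : 1 ≤ N.toReal := by
    have := ENNReal.toReal_mono hp.ne (MarkovProcess.one_le_eLpNorm_rnDeriv hν hpq.one_le)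
    simpa using this
  by_cases htriv : t * η * δ ^ 2 / (4 * M * √(4 * σ ^ 2 + δ ^ 2)) = 0
  · rw [htriv]
    have : (X.lawFrom ν).real {ω | δ ≤ |X.timeAverage f t ω|} ≤ 1 := measureReal_le_one
    simp only [mul_zero, neg_zero, Real.exp_zero, mul_one]
    linarith
  have ht0 : 0 < t := ht.lt_of_ne fun h => htriv (by simp [← h])
  have hδ0 : 0 < δ := hδ.lt_of_ne fun h => htriv (by simp [← h])
  have hM1 : 0 < M := hM0.lt_of_ne fun h => htriv (by simp [← h])
  set E := t * η * δ ^ 2 / (4 * M * √(4 * σ ^ 2 + δ ^ 2)) with hE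
  have hA : MeasurableSet {ω | δ ≤ |X.timeAverage f t ω|} := by
    have h1 : Measurable (X.timeAverage f t) := (X.measurable_pathIntegral hf 0 t).const_mul t⁻¹
    exact measurableSet_le measurable_const h1.abs
  set A := {ω | δ ≤ |X.timeAverage f t ω|}
  set c := q⁻¹.toReal with hc
  have hc1 : c ≤ 1 := by
    have : q⁻¹ ≤ 1 := ENNReal.inv_le_one.2 hpq.symm.one_le
    exact ENNReal.toReal_mono ENNReal.one_ne_top this
  have hstat := X.measureReal_le_abs_timeAverage_le hμ hη hf hM1 hM hmean hσ ht0 hδ0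
  have hhol := ENNReal.toReal_mono (ENNReal.mul_ne_top hp.ne
    (ENNReal.rpow_ne_top_of_nonneg ENNReal.toReal_nonneg (measure_ne_top _ _)))
    (X.lawFrom_le_eLpNorm_mul_rpow hν hpq hA)
  rw [ENNReal.toReal_mul, ← ENNReal.toReal_rpow] at hhol
  calc (X.lawFrom ν).real A ≤ N.toReal * ((X.lawFrom μ).real A) ^ c := hhol
    _ ≤ N.toReal * (2 * Real.exp (-E)) ^ c := by
        gcongr
    _ = N.toReal * (2 ^ c * Real.exp (-(c * E))) := by
        rw [Real.mul_rpow zero_le_two (Real.exp_pos _).le, ← Real.exp_mul]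
        congr 3
        ring
    _ ≤ N.toReal * (2 * Real.exp (-(c * E))) := by
        gcongr
        simpa using Real.rpow_le_rpow_of_exponent_le one_le_two hc1
    _ = _ := by ring
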